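/- Let $K$ be an algebraically closed field and $A$ a finite-dimensional basic $K$-algebra with a complete family $(e_i)_{i\in Q_0}$ of primitive orthogonal idempotents ($Q_0$ is the vertex set of the quiver of $A$), and let $\leqslant$ be a partial order on $Q_0$. Modules are finite-dimensional left $A$-modules. Let $P(i)=Ae_i$, $S(i)=\operatorname{top}P(i)$, $I(i)=\operatorname{Hom}_K(e_iA,K)$ and $[M:S(i)]=\dim_K e_iM$. Let $\Delta(i)$ be the largest factor module of $P(i)$, and $\nabla(i)$ the largest submodule of $I(i)$, with no composition factor $S(j)$ with $j\not\leqslant i$. A module is $\Delta$-good (resp. $\nabla$-good) if it has a finite filtration whose subquotients are all isomorphic to modules $\Delta(i)$ (resp. $\nabla(i)$); $(M:\Delta(i))$ is the number of subquotients isomorphic to $\Delta(i)$ in such a filtration of $M$. Assume that $(A,\leqslant)$ is 1-quasi-hereditary. That is, $(A,\leqslant)$ is quasi-hereditary: for all $i$, $[\Delta(i):S(i)]=1$ and $P(i)$ is $\Delta$-good with $(P(i):\Delta(i))=1$ and $(P(i):\Delta(j))=0$ for all $j\not\geqslant i$. Moreover: 1. $Q_0$ has a smallest element $1$ and a largest element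 $n$. 2. $[\Delta(i):S(j)]=(P(j):\Delta(i))=1$ whenever $j\leqslant i$. 3. $\operatorname{soc}P(j)\cong\operatorname{top}I(j)\cong S(1)$ for all $j$. 4. For all $i$ there are an injective homomorphism $\Delta(i)\to\Delta(n)$ and a surjective homomorphism $\nabla(n)\to\nabla(i)$. Let $j\in Q_0$ and $\Lambda^{(j)}=\{i\in Q_0\mid i\geqslant j\}$. Then, for every $i\in\Lambda^{(j)}$, the module $P(j)$ has exactly one submodule isomorphic to $P(i)$; denote it again by $P(i)$. For every $i\in Q_0$ there are surjective homomorphisms $P(1)\to I(i)$, and they all have the same kernel $\mathcal K(i)$; moreover $\mathcal K(j)\subseteq\mathcal K(i)$ for $i\in\Lambda^{(j)}$. With this notation: (1) A module $M$ with $\operatorname{top}M\cong S(j)$ is $\Delta$-good if and only if $$M\cong P(j)\Big/\Big(\sum_{i\in\Lambda}P(i)\Big)\quad\text{for some }\Lambda\subseteq\Lambda^{(j)}\setminus\{j\}.$$ (2) A module $N$ with $\operatorname{soc}N\cong S(j)$ is $\nabla$-good if and only if $$N\cong\Big(\bigcap_{i\in\Lambda}\mathcal K(i)\Big)\Big/\mathcal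 K(j)\quad\text{for some }\Lambda\subseteq\Lambda^{(j)}\setminus\{j\},$$ where the empty intersection is $P(1)$. -/

import Mathlib

/-! Finite dimensional basic algebras `A` over a field `K`, with a complete family `e : ι → A` of
primitive orthogonal idempotents (`ι` is the vertex set of the quiver, `e i` the trivial path at
`i`), and left `A`-modules. -/

namespace QH

universe u v w

/-! ### Top, socle, bounded filtrations -/

section Modules

variable (A : Type u) [Ring A] (M : Type v) [AddCommGroup M] [Module A M]

/-- The top `M / rad M` of a module; `rad M` is the intersection of the maximal submodules. -/
abbrev Top : Type v := M ⧸ Module.jacobson A M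

/-- The socle of a module: the sum of its simple submodules. -/
def socle : Submodule A M := sSup {N : Submodule A M | IsSimpleModule A N}

/-- The subquotient `D / D'` of a module (used for `D' ≤ D`). -/
abbrev Subquot {A : Type u} [Ring A] {M : Type v} [AddCommGroup M] [Module A M]
    (D D' : Submodule A M) : Type v := ↥D ⧸ D'.submoduleOf D

variable {ι : Type w} (X : ι → Type v) [∀ i, AddCommGroup (X i)] [∀ i, Module A (X i)]

/-- A filtration `0 = D 0 ≤ D 1 ≤ ⋯ ≤ D r = M` in which each subquotient is isomorphic to one of
the modules `X i`. -/
structure GoodFiltration (M : Type*) [AddCommGroup M] [Module A M] where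
  length : ℕ
  filt : Fin (length + 1) → Submodule A M
  mono : Monotone filt
  bot : filt 0 = ⊥
  top : filt (Fin.last length) = ⊤
  subquot : ∀ k : Fin length, ∃ i, Nonempty (Subquot (filt k.succ) (filt k.castSucc) ≃ₗ[A] X i)

/-- `M` has a filtration all of whose subquotients are isomorphic to members of the family `X`. -/
def IsGood (M : Type*) [AddCommGroup M] [Module A M] : Prop := Nonempty (GoodFiltration A X M)

variable {A X}

/-- The number of subquotients isomorphic to `X i` in a filtration. -/
noncomputable def GoodFiltration.count {M : Type*} [AddCommGroup M] [Module A M]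
    (F : GoodFiltration A X M) (i : ι) : ℕ :=
  Nat.card {k : Fin F.length //
    Nonempty (Subquot (F.filt k.succ) (F.filt k.castSucc) ≃ₗ[A] X i)}

variable (A X)

open Classical in
/-- The filtration multiplicity `(M : X i)`: the number of subquotients isomorphic to `X i` in some
filtration of `M` with subquotients in the family `X`. It is only used for standard modules, where
it does not depend on the filtration (and it is `0` by convention if there is no filtration). -/
noncomputable def filtMult (M : Type*) [AddCommGroup M] [Module A M] (i : ι) : ℕ :=
  if h : IsGood A X M then h.some.count i else 0

end Modules

/-! ### Projective, simple and injective indecomposables -/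

section Indecomposables

variable {A : Type u} [Ring A] {ι : Type w}

/-- `P(i) = A e_i`. -/
def P (e : ι → A) (i : ι) : Submodule A A := Submodule.span A {e i}

/-- `S(i)`, the top of `P(i)`. -/
abbrev S (e : ι → A) (i : ι) : Type u := Top A ↥(P e i)

/-- `e` is a complete family of primitive orthogonal idempotents of `A` and `A` is basic, i.e. the
modules `A e_i` are pairwise non-isomorphic. -/
structure IsBasicFamily [Fintype ι] (e : ι → A) : Prop where
  complete : CompleteOrthogonalIdempotents e
  ne_zero : ∀ i, e i ≠ 0
  primitive : ∀ i, ∀ x y : A, IsIdempotentElem x → IsIdempotentElem y → x * y = 0 → y * x = 0 →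
    x + y = e i → x = 0 ∨ y = 0
  basic : ∀ i j, Nonempty (↥(P e i) ≃ₗ[A] ↥(P e j)) → i = j

end Indecomposables

section Dual

variable (K : Type v) [Field K] (A : Type u) [Ring A] [Algebra K A]

/-- The `K`-dual `D(A) = Hom_K(A, K)` of the right regular module; it is the left `A`-module with
`(a • f) x = f (x * a)`. -/
def D : Type (max u v) := Module.Dual K A

instance : AddCommGroup (D K A) := inferInstanceAs (AddCommGroup (Module.Dual K A))

instance : Module K (D K A) := inferInstanceAs (Module K (Module.Dual K A))

instance : FunLike (D K A) A K := inferInstanceAs (FunLike (Module.Dual K A) A K)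

variable {K A} in
theorem D.ext {f g : D K A} (h : ∀ x, f x = g x) : f = g := DFunLike.ext _ _ h

instance : Module A (D K A) where
  smul a f := LinearMap.comp (show Module.Dual K A from f) (LinearMap.mulRight K a)
  one_smul f := D.ext fun x => congrArg f (mul_one x)
  mul_smul a b f := D.ext fun x => congrArg f (mul_assoc x a b).symm
  smul_zero _ := rfl
  smul_add _ _ _ := rfl
  add_smul a b f := D.ext fun x =>
    (congrArg f (mul_add x a b)).trans (map_add (show Module.Dual K A from f) _ _)
  zero_smul f := D.ext fun x =>
    (congrArg f (mul_zero x)).trans (map_zero (show Module.Dual K A from f))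

variable {K A}

theorem D.smul_apply (a : A) (f : D K A) (x : A) : (a • f) x = f (x * a) := rfl

theorem D.add_apply (f g : D K A) (x : A) : (f + g) x = f x + g x := rfl

theorem D.zero_apply (x : A) : (0 : D K A) x = 0 := rfl

theorem D.kSmul_apply (c : K) (f : D K A) (x : A) : (c • f) x = c * f x := rfl

instance : IsScalarTower K A (D K A) where
  smul_assoc c a f := D.ext fun x => by
    rw [D.smul_apply, D.kSmul_apply, D.smul_apply, mul_smul_comm]
    exact map_smul (show Module.Dual K A from f) c (x * a)

instance [FiniteDimensional K A] : FiniteDimensional K (D K A) :=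
  inferInstanceAs (FiniteDimensional K (Module.Dual K A))

variable (K) {ι : Type w}

/-- `I(i) = D(e_i A)`, realized inside `D(A)` as the functionals `f` with `f (e_i x) = f x`, i.e.
those that vanish on the complement `(1 - e_i) A` of `e_i A`. -/
def I (e : ι → A) (i : ι) : Submodule A (D K A) where
  carrier := {f | ∀ x, f (e i * x) = f x}
  add_mem' {f g} hf hg x := by
    rw [D.add_apply, D.add_apply, hf x, hg x]
  zero_mem' _ := rfl
  smul_mem' a f hf x := by
    rw [D.smul_apply, D.smul_apply, mul_assoc, hf]

end Dual

/-! ### Standard and costandard modules, quasi-hereditary algebras -/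

section QuasiHereditary

variable (K : Type v) [Field K] {A : Type u} [Ring A] [Algebra K A] {ι : Type w}

/-- The Jordan-Hölder multiplicity `[M : S(i)] = dim_K (e_i M)`. -/
noncomputable def mult (e : ι → A) (M : Type*) [AddCommGroup M] [Module K M] [Module A M]
    [IsScalarTower K A M] (i : ι) : ℕ :=
  Module.finrank K (LinearMap.range (Algebra.lsmul K K M (e i)))

theorem mult_eq_zero_iff (e : ι → A) (M : Type*) [AddCommGroup M] [Module K M] [Module A M]
    [IsScalarTower K A M] [FiniteDimensional K M] (i : ι) :
    mult K e M i = 0 ↔ ∀ m : M, e i • m = 0 := by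
  rw [mult, Submodule.finrank_eq_zero, LinearMap.range_eq_bot]
  exact ⟨fun h m => congrArg (fun f => f m) h, fun h => LinearMap.ext h⟩

variable [PartialOrder ι]

/-- The smallest submodule `U` of `P(i)` such that `[P(i)/U : S(j)] = 0` for all `j ≰ i`. -/
def stdKer (e : ι → A) (i : ι) : Submodule A ↥(P e i) :=
  sInf {U : Submodule A ↥(P e i) | ∀ j, ¬ j ≤ i → mult K e (↥(P e i) ⧸ U) j = 0}

theorem stdKer_isLeast [FiniteDimensional K A] (e : ι → A) (i : ι) :
    IsLeast {U : Submodule A ↥(P e i) | ∀ j, ¬ j ≤ i → mult K e (↥(P e i) ⧸ U) j = 0}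
      (stdKer K e i) := by
  refine ⟨fun j hj => ?_, fun U hU => sInf_le hU⟩
  have : FiniteDimensional K ↥(P e i) :=
    inferInstanceAs (FiniteDimensional K ↥((P e i).restrictScalars K))
  have fin (U : Submodule A ↥(P e i)) : FiniteDimensional K (↥(P e i) ⧸ U) :=
    Module.Finite.of_surjective (U.mkQ.restrictScalars K) U.mkQ_surjective
  rw [mult_eq_zero_iff]
  intro m
  obtain ⟨x, rfl⟩ := Submodule.mkQ_surjective _ m
  rw [← map_smul, Submodule.mkQ_apply, Submodule.Quotient.mk_eq_zero, stdKer, Submodule.mem_sInf]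
  intro U hU
  have h := (mult_eq_zero_iff K e _ j).1 (hU j hj) (U.mkQ x)
  rwa [← map_smul, Submodule.mkQ_apply, Submodule.Quotient.mk_eq_zero] at h

/-- The standard module `Δ(i)`: the largest factor module of `P(i)` with `[Δ(i) : S(j)] = 0` for
all `j ≰ i`. -/
abbrev Std (e : ι → A) (i : ι) : Type u := ↥(P e i) ⧸ stdKer K e i

/-- The costandard module `∇(i)`: the largest submodule of `I(i)` with `[∇(i) : S(j)] = 0` for
all `j ≰ i`. -/
def Costd (e : ι → A) (i : ι) : Submodule A ↥(I K e i) :=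
  sSup {U : Submodule A ↥(I K e i) | ∀ j, ¬ j ≤ i → mult K e ↥U j = 0}

theorem costd_isGreatest [FiniteDimensional K A] (e : ι → A) (i : ι) :
    IsGreatest {U : Submodule A ↥(I K e i) | ∀ j, ¬ j ≤ i → mult K e ↥U j = 0}
      (Costd K e i) := by
  refine ⟨fun j hj => ?_, fun U hU => le_sSup hU⟩
  have : FiniteDimensional K ↥(I K e i) :=
    inferInstanceAs (FiniteDimensional K ↥((I K e i).restrictScalars K))
  have fin (U : Submodule A ↥(I K e i)) : FiniteDimensional K ↥U :=
    inferInstanceAs (FiniteDimensional K ↥(U.restrictScalars K))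
  rw [mult_eq_zero_iff]
  rintro ⟨m, hm⟩
  refine Subtype.ext ?_
  change e j • m = 0
  rw [Costd, sSup_eq_iSup'] at hm
  induction hm using Submodule.iSup_induction' with
  | mem U x hx =>
    exact congrArg Subtype.val ((mult_eq_zero_iff K e _ j).1 (U.2 j hj) ⟨x, hx⟩)
  | zero => exact smul_zero _
  | add x y _ _ hx hy => rw [smul_add, hx, hy, add_zero]

/-- `M` is `Δ`-good. -/
def IsDeltaGood (e : ι → A) (M : Type*) [AddCommGroup M] [Module A M] : Prop :=
  IsGood A (Std K e) M

/-- `M` is `∇`-good. -/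
def IsNablaGood (e : ι → A) (M : Type*) [AddCommGroup M] [Module A M] : Prop :=
  IsGood A (fun i => ↥(Costd K e i)) M

/-- `(M : Δ(i))`. -/
noncomputable def deltaMult (e : ι → A) (M : Type*) [AddCommGroup M] [Module A M] (i : ι) : ℕ :=
  filtMult A (Std K e) M i

/-- The algebra `A` with the partial order on its vertices is quasi-hereditary. -/
structure IsQuasiHereditary (e : ι → A) : Prop where
  mult_std_self : ∀ i, mult K e (Std K e i) i = 1
  deltaGood : ∀ i, IsDeltaGood K e ↥(P e i)
  deltaMult_eq_zero : ∀ i j, ¬ i ≤ j → deltaMult K e ↥(P e i) j = 0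
  deltaMult_self : ∀ i, deltaMult K e ↥(P e i) i = 1

/-- The algebra `A` with the partial order on its vertices is 1-quasi-hereditary; `⊥` and `⊤` are
the smallest and the largest vertex (written `1` and `n` in the literature). -/
structure IsOneQuasiHereditary [BoundedOrder ι] (e : ι → A) : Prop
    extends IsQuasiHereditary K e where
  mult_std : ∀ i j, j ≤ i → mult K e (Std K e i) j = 1
  deltaMult_proj : ∀ i j, j ≤ i → deltaMult K e ↥(P e j) i = 1
  socle_proj : ∀ j, Nonempty (↥(socle A ↥(P e j)) ≃ₗ[A] S e ⊥)
  top_inj : ∀ j, Nonempty (Top A ↥(I K e j) ≃ₗ[A] S e ⊥)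
  std_embeds : ∀ i, ∃ f : Std K e i →ₗ[A] Std K e ⊤, Function.Injective f
  costd_covers : ∀ i, ∃ f : ↥(Costd K e ⊤) →ₗ[A] ↥(Costd K e i), Function.Surjective f

end QuasiHereditary

/-! ### `P(i)` inside `P(j)`, and the kernels of `P(1) ↠ I(i)` -/

section Sub

variable {A : Type u} [Ring A] {ι : Type w}

/-- `P(i)` as a submodule of `P(j)`: the submodule of `P(j)` isomorphic to `P(i)`. It is used for
`j ≤ i`, when there is exactly one such submodule. -/
def projSub (e : ι → A) (j i : ι) : Submodule A ↥(P e j) :=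
  sSup {N | Nonempty (↥N ≃ₗ[A] ↥(P e i))}

/-- The kernel of the surjection from `P(1)` onto `I(i)`, with `1 = ⊥`. All such surjections have
the same kernel. -/
def kerInj (K : Type v) [Field K] [Algebra K A] [PartialOrder ι] [BoundedOrder ι]
    (e : ι → A) (i : ι) : Submodule A ↥(P e ⊥) :=
  sSup {N | ∃ f : ↥(P e ⊥) →ₗ[A] ↥(I K e i), Function.Surjective f ∧ N = LinearMap.ker f}

end Sub

end QH

namespace QH
universe u v w

/-! ### Finite upper sets and the deletion of minimal elements -/

section Combinatorics

variable {ι : Type*} [PartialOrder ι]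

/-! The theorem is governed by dimension counts. As `[Δ(l):S(m)]` is 1 for `m ≤ l` and 0 otherwise,
and `P(j)` contains each `Δ(l)` with `l ≥ j` exactly once, `[P(j):S(m)]` is the number of `l ≥ m`
whenever `j ≤ m`, independently of `j`, and the number of `l ≥ j` whenever `m ≤ j` (`mult_P_of_le`,
`mult_P_of_ge`). Counting gives `P(1) ≅ I(1)`, so every `P(j)`, having socle `S(1)`, embeds in
`P(1)`. Further counting identifies the copy of `P(i)` in `P(j)` with the trace `A e_i P(j)`, and
`𝒦(i)` with the reject, the largest submodule of `P(1)` killed by `e_i`. Both descriptions are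
intrinsic, which gives uniqueness; monotonicity in `i` is again a count.

For an upper set `Λ` of vertices above `j`, take the sum of the traces over `Λ`. Deleting a minimal
`k` from `Λ` changes it by a quotient of `Δ(k)`; since the whole chain from `P(j)` to 0 must account
for all of `P(j)`, each such quotient is `Δ(k)` itself (`upper_count`, `mult_traces`). Hence the
factor modules by these sums are `Δ`-good. Conversely, descend a good filtration from `P(j)`: if `V`
is the sum for `Λ` and `V/U ≅ Δ(k)`, a simple quotient of `Δ(k)` forces `k` to be minimal in `Λ`;
the other `e_l`, `l ∈ Λ`, kill `Δ(k)`, so `U` contains the sum for `Λ \ {k}` and equals it by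
dimension (`exists_eq_traces`). An arbitrary `Λ` can be replaced by the upper set it generates.

The `∇` statement is the dual argument inside `P(1)`: intersections of rejects replace sums of
traces, the filtration is climbed from `𝒦(j)`, and simple submodules of `∇(k)` replace simple
quotients of `Δ(k)` (`mult_rejects_add`, `exists_eq_rejects`). -/

theorem isUpperSet_erase [DecidableEq ι] {Λ : Finset ι} (hΛ : IsUpperSet (Λ : Set ι)) {k : ι}
    (hmin : ∀ l ∈ Λ, ¬ l < k) : IsUpperSet ((Λ.erase k : Finset ι) : Set ι) := by
  intro a b hab ha
  rw [Finset.mem_coe, Finset.mem_erase] at ha ⊢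
  refine ⟨?_, hΛ hab ha.2⟩
  rintro rfl
  exact hmin a ha.2 (lt_of_le_of_ne hab ha.1)

open Classical in
-- A maximal element of `Ω \ Λ` can be added to `Λ` keeping it an upper set, and it is minimal
-- there; so deleting minimal elements one at a time leads from `Ω` to `Λ`.
theorem upper_induction {Ω : Finset ι} (hΩ : IsUpperSet (Ω : Set ι)) {motive : Finset ι → Prop}
    (top : motive Ω)
    (step : ∀ Λ ⊆ Ω, IsUpperSet (Λ : Set ι) → ∀ k ∈ Λ, (∀ l ∈ Λ, ¬ l < k) →
      motive Λ → motive (Λ.erase k))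
    {Λ : Finset ι} (hΛ : IsUpperSet (Λ : Set ι)) (hsub : Λ ⊆ Ω) : motive Λ := by
  induction h : (Ω \ Λ).card generalizing Λ with
  | zero =>
    rw [Finset.card_eq_zero, Finset.sdiff_eq_empty_iff_subset] at h
    rwa [hsub.antisymm h]
  | succ n ih =>
    obtain ⟨k, hk⟩ := (Ω \ Λ).exists_maximal (Finset.card_pos.1 (by omega))
    have hkΩ := (Finset.mem_sdiff.1 hk.prop).1
    have hkΛ := (Finset.mem_sdiff.1 hk.prop).2
    have hup : IsUpperSet ((insert k Λ : Finset ι) : Set ι) := by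
      intro a b hab ha
      simp only [Finset.coe_insert, Set.mem_insert_iff, Finset.mem_coe] at ha ⊢
      rcases ha with rfl | ha
      · by_cases hb : b ∈ Λ
        · exact Or.inr hb
        · exact Or.inl (le_antisymm (hk.le_of_ge (Finset.mem_sdiff.2 ⟨hΩ hab hkΩ, hb⟩) hab) hab)
      · exact Or.inr (hΛ hab ha)
    have hss : insert k Λ ⊆ Ω := Finset.insert_subset hkΩ hsub
    have := step _ hss hup k (Finset.mem_insert_self _ _) (by
      intro l hl hlk
      rcases Finset.mem_insert.1 hl with rfl | hl
      · exact lt_irrefl _ hlk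
      · exact hkΛ (hΛ hlk.le hl)) (ih hup hss (by
        rw [Finset.sdiff_insert, Finset.card_erase_of_mem hk.prop, h]; rfl))
    rwa [Finset.erase_insert hkΛ] at this

open Classical in
-- A squeeze: a chain from `Λ` down to `∅` bounds `g Λ` above, a chain from `Ω` down to `Λ` bounds
-- it below, and `total` makes the bounds meet.
theorem upper_count {Ω : Finset ι} (hΩ : IsUpperSet (Ω : Set ι)) (g : Finset ι → ℕ) (d : ι → ℕ)
    (empty : g ∅ = 0)
    (step : ∀ Λ ⊆ Ω, IsUpperSet (Λ : Set ι) → ∀ k ∈ Λ, (∀ l ∈ Λ, ¬ l < k) →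
      g Λ ≤ g (Λ.erase k) + d k)
    (total : ∑ k ∈ Ω, d k ≤ g Ω)
    {Λ : Finset ι} (hΛ : IsUpperSet (Λ : Set ι)) (hsub : Λ ⊆ Ω) : g Λ = ∑ k ∈ Λ, d k := by
  have key : ∀ Θ ⊆ Ω, IsUpperSet (Θ : Set ι) → ∀ Λ ⊆ Θ, IsUpperSet (Λ : Set ι) →
      g Θ ≤ g Λ + ∑ k ∈ Θ \ Λ, d k := by
    intro Θ hΘΩ hΘ Λ hΛΘ hΛ
    refine upper_induction (motive := fun Λ => g Θ ≤ g Λ + ∑ k ∈ Θ \ Λ, d k) hΘ (by simp) ?_ hΛ hΛΘ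
    intro Λ hΛΘ hΛ k hk hmin ih
    have h1 := step Λ (hΛΘ.trans hΘΩ) hΛ k hk hmin
    have h2 : Θ \ Λ.erase k = insert k (Θ \ Λ) := by
      rw [Finset.sdiff_erase (hΛΘ hk)]
    rw [h2, Finset.sum_insert (by simp [hk])]
    omega
  have h1 := key Λ hsub hΛ ∅ (Finset.empty_subset _) (by simp [isUpperSet_empty])
  have h2 := key Ω subset_rfl hΩ Λ hsub hΛ
  have h3 := Finset.sum_sdiff (f := d) hsub
  simp only [Finset.sdiff_empty, empty] at h1
  omega

end Combinatorics

/-! ### Good filtrations as chains of steps -/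

section Filtrations

variable {A : Type*} [Ring A] {ι : Type*} (X : ι → Type*) [∀ i, AddCommGroup (X i)]
  [∀ i, Module A (X i)] {M N : Type*} [AddCommGroup M] [Module A M] [AddCommGroup N] [Module A N]

/-- `V / U` is isomorphic to a member of the family `X`. -/
def Step (U V : Submodule A M) : Prop := U ≤ V ∧ ∃ i, Nonempty (Subquot V U ≃ₗ[A] X i)

/-- The subquotient `V / U` is the image of any map out of `V` with kernel `U`. -/
noncomputable def subquotEquiv {U V : Submodule A M} (f : V →ₗ[A] N) (hf : Function.Surjective f)
    (hk : ∀ x : V, f x = 0 ↔ (x : M) ∈ U) : Subquot V U ≃ₗ[A] N :=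
  (Submodule.quotEquivOfEq _ _ (by ext x; exact (hk x).symm)).trans
    (f.quotKerEquivOfSurjective hf)

theorem exists_of_subquotEquiv {U V : Submodule A M} (φ : Subquot V U ≃ₗ[A] N) :
    ∃ f : V →ₗ[A] N, Function.Surjective f ∧ ∀ x : V, f x = 0 ↔ (x : M) ∈ U := by
  refine ⟨φ.toLinearMap ∘ₗ (U.submoduleOf V).mkQ, φ.surjective.comp (Submodule.mkQ_surjective _),
    fun x => ?_⟩
  change φ ((U.submoduleOf V).mkQ x) = 0 ↔ _
  rw [LinearEquiv.map_eq_zero_iff, Submodule.mkQ_apply, Submodule.Quotient.mk_eq_zero]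
  rfl

variable {X}

theorem Step.comap {U V : Submodule A N} (h : Step X U V) (f : M →ₗ[A] N)
    (hf : Function.Surjective f) : Step X (U.comap f) (V.comap f) := by
  obtain ⟨hUV, i, ⟨φ⟩⟩ := h
  obtain ⟨g, hg, hk⟩ := exists_of_subquotEquiv φ
  refine ⟨Submodule.comap_mono hUV, i, ⟨subquotEquiv
    (g ∘ₗ f.restrict (p := V.comap f) (q := V) fun x hx => hx) ?_ fun x => hk _⟩⟩
  intro y
  obtain ⟨⟨z, hz⟩, rfl⟩ := hg y
  obtain ⟨x, rfl⟩ := hf z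
  exact ⟨⟨x, hz⟩, rfl⟩

theorem Step.of_comap {U V : Submodule A N} (f : M →ₗ[A] N) (hf : Function.Surjective f)
    (h : Step X (U.comap f) (V.comap f)) : Step X U V := by
  obtain ⟨hUV, i, ⟨φ⟩⟩ := h
  have hUV' : U ≤ V := fun y hy => by
    obtain ⟨x, rfl⟩ := hf y
    exact hUV hy
  refine ⟨hUV', i, ⟨LinearEquiv.trans (subquotEquiv (U := U.comap f) (V := V.comap f)
    ((U.submoduleOf V).mkQ ∘ₗ f.restrict (p := V.comap f) (q := V) fun x hx => hx) ?_
    fun x => ?_).symm φ⟩⟩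
  · intro y
    obtain ⟨⟨z, hz⟩, rfl⟩ := Submodule.mkQ_surjective _ y
    obtain ⟨x, rfl⟩ := hf z
    exact ⟨⟨x, hz⟩, rfl⟩
  · exact Submodule.Quotient.mk_eq_zero _

/-- As a chain of relations, a filtration can be extended or peeled off by induction at either end.
-/
theorem isGood_iff_reflTransGen :
    IsGood A X M ↔ Relation.ReflTransGen (Step X) (⊥ : Submodule A M) ⊤ := by
  constructor
  · rintro ⟨F⟩
    have key : ∀ n (hn : n < F.length + 1),
        Relation.ReflTransGen (Step X) (⊥ : Submodule A M) (F.filt ⟨n, hn⟩) := by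
      intro n
      induction n with
      | zero =>
        intro hn
        rw [← F.bot]
        exact .refl
      | succ n ih =>
        intro hn
        exact (ih (by omega)).tail ⟨F.mono (Fin.mk_le_mk.2 (Nat.le_succ n)),
          F.subquot ⟨n, by omega⟩⟩
    rw [← F.top]
    exact key _ (Nat.lt_succ_self _)
  · intro h
    -- The sequence is indexed by all of `ℕ` and constant from `n` on, so that appending a step
    -- needs no casts.
    have key : ∀ W : Submodule A M, Relation.ReflTransGen (Step X) (⊥ : Submodule A M) W →
        ∃ (n : ℕ) (f : ℕ → Submodule A M), f 0 = ⊥ ∧ (∀ k, n ≤ k → f k = W) ∧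
          ∀ k < n, Step X (f k) (f (k + 1)) := by
      intro W hW
      induction hW with
      | refl => exact ⟨0, fun _ => ⊥, rfl, fun _ _ => rfl, fun k hk => absurd hk (by omega)⟩
      | @tail V W _ hVW ih =>
        obtain ⟨n, f, h0, hn, hs⟩ := ih
        refine ⟨n + 1, fun k => if k ≤ n then f k else W, by simpa using h0, fun k hk => ?_,
          fun k hk => ?_⟩
        · exact if_neg (by omega)
        · rcases Nat.lt_succ_iff_lt_or_eq.1 hk with hk | rfl
          · beta_reduce
            rw [if_pos (by omega), if_pos (by omega)]
            exact hs k hk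
          · beta_reduce
            rw [if_pos le_rfl, if_neg (by omega), hn k le_rfl]
            exact hVW
    obtain ⟨n, f, h0, hn, hs⟩ := key _ h
    refine ⟨⟨n, fun k => f k, ?_, h0, hn _ (by simp), fun k => (hs k k.2).2⟩⟩
    rw [Fin.monotone_iff_le_succ]
    exact fun k => (hs k k.2).1

/-- The correspondence theorem: submodules of the image match submodules above the kernel, with the
same subquotients. -/
theorem isGood_iff_of_surjective (f : M →ₗ[A] N) (hf : Function.Surjective f) :
    IsGood A X N ↔ Relation.ReflTransGen (Step X) (LinearMap.ker f) ⊤ := by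
  rw [isGood_iff_reflTransGen]
  constructor
  · intro h
    have := h.lift (Submodule.comap f) fun U V hUV => hUV.comap f hf
    rwa [Function.onFun, Submodule.comap_bot, Submodule.comap_top] at this
  · intro h
    have key : ∀ W, Relation.ReflTransGen (Step X) (LinearMap.ker f) W →
        LinearMap.ker f ≤ W ∧ Relation.ReflTransGen (Step X) ⊥ (W.map f) := by
      intro W hW
      induction hW with
      | refl => exact ⟨le_rfl, by
        rw [LinearMap.le_ker_iff_map.1 le_rfl]⟩
      | @tail V W _ hVW ih =>
        have hW := ih.1.trans hVW.1
        refine ⟨hW, ih.2.tail (Step.of_comap f hf ?_)⟩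
        rwa [Submodule.comap_map_eq, Submodule.comap_map_eq, sup_eq_left.2 ih.1,
          sup_eq_left.2 hW]
    have := (key _ h).2
    rwa [Submodule.map_top, LinearMap.range_eq_top.2 hf] at this

theorem Step.map_subtype {V : Submodule A M} {U W : Submodule A V} (h : Step X U W) :
    Step X (U.map V.subtype) (W.map V.subtype) := by
  obtain ⟨hUW, i, ⟨φ⟩⟩ := h
  obtain ⟨g, hg, hk⟩ := exists_of_subquotEquiv φ
  let ε := W.equivMapOfInjective V.subtype V.injective_subtype
  refine ⟨Submodule.map_mono hUW, i, ⟨subquotEquiv (g ∘ₗ ε.symm.toLinearMap)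
    (hg.comp ε.symm.surjective) fun x => ?_⟩⟩
  obtain ⟨y, rfl⟩ := ε.surjective x
  simp only [LinearMap.comp_apply, LinearEquiv.coe_coe, LinearEquiv.symm_apply_apply, hk]
  change _ ↔ V.subtype (y : V) ∈ _
  rw [Submodule.mem_map]
  exact ⟨fun h => ⟨_, h, rfl⟩, fun ⟨z, hz, h⟩ => V.injective_subtype h ▸ hz⟩

theorem Step.submoduleOf {V U W : Submodule A M} (hW : W ≤ V) (h : Step X U W) :
    Step X (U.submoduleOf V) (W.submoduleOf V) := by
  obtain ⟨hUW, i, ⟨φ⟩⟩ := h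
  obtain ⟨g, hg, hk⟩ := exists_of_subquotEquiv φ
  let ε := Submodule.submoduleOfEquivOfLe hW
  refine ⟨Submodule.comap_mono hUW, i, ⟨subquotEquiv (g ∘ₗ ε.toLinearMap)
    (hg.comp ε.surjective) fun x => hk _⟩⟩

theorem isGood_iff_of_subquot {U V : Submodule A M} (hUV : U ≤ V) (φ : N ≃ₗ[A] Subquot V U) :
    IsGood A X N ↔ Relation.ReflTransGen (Step X) U V := by
  obtain ⟨f, hf, hk⟩ := exists_of_subquotEquiv φ.symm
  have hker : LinearMap.ker f = U.submoduleOf V := by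
    ext x
    exact hk x
  rw [isGood_iff_of_surjective f hf, hker]
  constructor
  · intro h
    have := h.lift (Submodule.map V.subtype) fun _ _ h => h.map_subtype
    rwa [Function.onFun, Submodule.map_subtype_top, Submodule.submoduleOf, Submodule.map_comap_subtype, inf_eq_right.2 hUV] at this
  · intro h
    have key : ∀ W, Relation.ReflTransGen (Step X) U W → W ≤ V →
        Relation.ReflTransGen (Step X) (U.submoduleOf V) (W.submoduleOf V) := by
      intro W hW
      induction hW with
      | refl => exact fun _ => .refl
      | tail _ h ih => exact fun hV => (ih (h.1.trans hV)).tail (h.submoduleOf hV)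
    have := key V h le_rfl
    rwa [Submodule.submoduleOf_self] at this

end Filtrations

/-! ### Additivity of multiplicities -/

section Mult

variable {K : Type*} [Field K] {A : Type*} [Ring A] [Algebra K A] {ι : Type*} {e : ι → A}
  {M N : Type*} [AddCommGroup M] [Module K M] [Module A M] [IsScalarTower K A M]
  [AddCommGroup N] [Module K N] [Module A N] [IsScalarTower K A N]

instance finiteDimensional_submodule [FiniteDimensional K M] (U : Submodule A M) :
    FiniteDimensional K U :=
  inferInstanceAs (FiniteDimensional K (U.restrictScalars K))

instance finiteDimensional_quotient [FiniteDimensional K M] (U : Submodule A M) :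
    FiniteDimensional K (M ⧸ U) :=
  Module.Finite.of_surjective (U.mkQ.restrictScalars K) U.mkQ_surjective

variable (K M) in
/-- The subspace `a M` of a module `M`. -/
abbrev smulRange (a : A) : Submodule K M := LinearMap.range (Algebra.lsmul K K M a)

theorem mem_smulRange {a : A} (ha : IsIdempotentElem a) {x : M} :
    x ∈ smulRange K M a ↔ a • x = x := by
  constructor
  · rintro ⟨y, rfl⟩
    change a • a • y = a • y
    rw [← mul_smul, ha]
  · exact fun h => ⟨x, h⟩

theorem mult_congr (φ : M ≃ₗ[A] N) (m : ι) : mult K e M m = mult K e N m := by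
  have h : (smulRange K M (e m)).map (φ.restrictScalars K).toLinearMap = smulRange K N (e m) := by
    ext y
    constructor
    · rintro ⟨_, ⟨x, rfl⟩, rfl⟩
      exact ⟨φ x, (map_smul φ _ _).symm⟩
    · rintro ⟨y, rfl⟩
      exact ⟨_, ⟨φ.symm y, rfl⟩, (map_smul φ _ _).trans (by simp)⟩
  exact (LinearEquiv.finrank_eq ((φ.restrictScalars K).submoduleMap _)).trans
    (congrArg (fun V : Submodule K N => Module.finrank K V) h)

/-- Multiplying by an idempotent is exact, so this is rank-nullity for `e_m M → e_m N`. -/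
theorem mult_eq_add_ker [FiniteDimensional K M] {m : ι} (hm : IsIdempotentElem (e m))
    (f : M →ₗ[A] N) (hf : Function.Surjective f) :
    mult K e M m = mult K e N m + mult K e (LinearMap.ker f) m := by
  let g : smulRange K M (e m) →ₗ[K] smulRange K N (e m) :=
    (f.restrictScalars K).restrict fun x hx => by
      rw [mem_smulRange hm] at hx ⊢
      change e m • f x = f x
      rw [← map_smul, hx]
  have hg : LinearMap.range g = ⊤ := by
    rw [LinearMap.range_eq_top]
    rintro ⟨y, hy⟩
    obtain ⟨x, rfl⟩ := hf y
    refine ⟨⟨e m • x, x, rfl⟩, Subtype.ext ?_⟩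
    exact (map_smul f _ _).trans ((mem_smulRange hm).1 hy)
  have h := LinearMap.finrank_range_add_finrank_ker g
  rw [hg, finrank_top] at h
  have hk : (LinearMap.ker g).map (smulRange K M (e m)).subtype =
      (smulRange K (LinearMap.ker f) (e m)).map ((LinearMap.ker f).subtype.restrictScalars K) := by
    ext x
    constructor
    · rintro ⟨⟨x, hx⟩, hx', rfl⟩
      exact ⟨⟨x, congrArg Subtype.val hx'⟩,
        (mem_smulRange hm).2 (Subtype.ext ((mem_smulRange hm).1 hx)), rfl⟩
    · rintro ⟨⟨x, hx⟩, hx', rfl⟩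
      exact ⟨⟨x, (mem_smulRange hm).2 (congrArg Subtype.val ((mem_smulRange hm).1 hx'))⟩,
        Subtype.ext hx, rfl⟩
  have h1 := ((LinearMap.ker g).equivMapOfInjective _
    (smulRange K M (e m)).injective_subtype).finrank_eq
  have h2 := ((smulRange K (LinearMap.ker f) (e m)).equivMapOfInjective
    ((LinearMap.ker f).subtype.restrictScalars K) (LinearMap.ker f).injective_subtype).finrank_eq
  rw [hk] at h1
  change Module.finrank K (smulRange K M (e m)) = Module.finrank K (smulRange K N (e m)) +
    Module.finrank K (smulRange K (LinearMap.ker f) (e m))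
  omega

theorem mult_le_of_surjective [FiniteDimensional K M] {m : ι} (hm : IsIdempotentElem (e m))
    (f : M →ₗ[A] N) (hf : Function.Surjective f) : mult K e N m ≤ mult K e M m := by
  rw [mult_eq_add_ker hm f hf]
  omega

theorem mult_eq_quotient_add [FiniteDimensional K M] {m : ι} (hm : IsIdempotentElem (e m))
    (U : Submodule A M) : mult K e M m = mult K e (M ⧸ U) m + mult K e U m := by
  rw [mult_eq_add_ker hm _ U.mkQ_surjective, mult_congr (LinearEquiv.ofEq _ _ U.ker_mkQ)]

theorem mult_le_of_injective [FiniteDimensional K N] {m : ι} (hm : IsIdempotentElem (e m))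
    (f : M →ₗ[A] N) (hf : Function.Injective f) : mult K e M m ≤ mult K e N m := by
  rw [mult_congr (LinearEquiv.ofInjective f hf), mult_eq_quotient_add hm (LinearMap.range f)]
  omega

theorem mult_submodule_le [FiniteDimensional K M] {m : ι} (hm : IsIdempotentElem (e m))
    (U : Submodule A M) : mult K e U m ≤ mult K e M m :=
  mult_le_of_injective hm U.subtype U.injective_subtype

theorem mult_eq_add_of_subquot [FiniteDimensional K M] {m : ι} (hm : IsIdempotentElem (e m))
    {U V : Submodule A M} (hUV : U ≤ V) (f : V →ₗ[A] N) (hf : Function.Surjective f)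
    (hk : ∀ x : V, f x = 0 ↔ (x : M) ∈ U) :
    mult K e V m = mult K e N m + mult K e U m := by
  have : LinearMap.ker f = U.submoduleOf V := by
    ext x
    exact hk x
  rw [mult_eq_add_ker hm f hf, mult_congr (LinearEquiv.ofEq _ _ this),
    mult_congr (Submodule.submoduleOfEquivOfLe hUV)]

theorem mult_eq_range_add [FiniteDimensional K M] {m : ι} (hm : IsIdempotentElem (e m))
    {U V : Submodule A M} (hUV : U ≤ V) (f : V →ₗ[A] N) (hk : ∀ x : V, f x = 0 ↔ (x : M) ∈ U) :
    mult K e V m = mult K e (LinearMap.range f) m + mult K e U m := by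
  refine mult_eq_add_of_subquot hm hUV f.rangeRestrict f.surjective_rangeRestrict fun x => ?_
  rw [← hk x]
  exact Subtype.ext_iff

theorem mult_eq_subquot_add [FiniteDimensional K M] {m : ι} (hm : IsIdempotentElem (e m))
    {U V : Submodule A M} (hUV : U ≤ V) :
    mult K e V m = mult K e (Subquot V U) m + mult K e U m :=
  mult_eq_add_of_subquot hm hUV (U.submoduleOf V).mkQ (Submodule.mkQ_surjective _)
    fun _ => Submodule.Quotient.mk_eq_zero _

theorem smul_mem_of_mult_le [FiniteDimensional K M] {m : ι} (hm : IsIdempotentElem (e m))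
    {U : Submodule A M} (h : mult K e M m ≤ mult K e U m) (x : M) : e m • x ∈ U := by
  rw [mult_eq_quotient_add hm U] at h
  have h0 := (mult_eq_zero_iff K e (M ⧸ U) m).1 (by omega) (U.mkQ x)
  rwa [← map_smul, Submodule.mkQ_apply, Submodule.Quotient.mk_eq_zero] at h0

theorem smul_mem_of_mult_le_of_le [FiniteDimensional K M] {m : ι} (hm : IsIdempotentElem (e m))
    {U V : Submodule A M} (hUV : U ≤ V) (h : mult K e V m ≤ mult K e U m) {x : M} (hx : x ∈ V) :
    e m • x ∈ U := by
  rw [← mult_congr (Submodule.submoduleOfEquivOfLe hUV)] at h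
  exact smul_mem_of_mult_le hm h ⟨x, hx⟩

section Complete

variable [Fintype ι] (he : CompleteOrthogonalIdempotents e)
include he

theorem sum_smul_eq {M : Type*} [AddCommGroup M] [Module A M] (x : M) : ∑ i, e i • x = x := by
  rw [← Finset.sum_smul, he.complete, one_smul]

/-- Since the `e_m` sum to 1, a module is recovered from its parts `e_m M`. This turns inequalities
of multiplicities into equalities of submodules. -/
theorem eq_of_mult_le [FiniteDimensional K M] {U V : Submodule A M} (hUV : U ≤ V)
    (h : ∀ m, mult K e V m ≤ mult K e U m) : U = V := by
  refine hUV.antisymm fun x hx => ?_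
  rw [← sum_smul_eq he x]
  exact Submodule.sum_mem _ fun m _ => smul_mem_of_mult_le_of_le (he.idem m) hUV (h m) hx

theorem eq_top_of_mult_le [FiniteDimensional K M] {U : Submodule A M}
    (h : ∀ m, mult K e M m ≤ mult K e U m) : U = ⊤ := by
  rw [Submodule.eq_top_iff']
  intro x
  rw [← sum_smul_eq he x]
  exact Submodule.sum_mem _ fun m _ => smul_mem_of_mult_le (he.idem m) (h m) x

theorem injective_of_mult_le [FiniteDimensional K M] (f : M →ₗ[A] N) (hf : Function.Surjective f)
    (h : ∀ m, mult K e M m ≤ mult K e N m) : Function.Injective f := by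
  rw [← LinearMap.ker_eq_bot]
  refine (eq_of_mult_le (K := K) he bot_le fun m => ?_).symm
  have := h m
  rw [mult_eq_add_ker (he.idem m) f hf] at this
  omega

end Complete

end Mult

/-! ### Traces and rejects -/

section TraceReject

variable {A : Type*} [Ring A] {ι : Type*} (e : ι → A) {M N : Type*} [AddCommGroup M] [Module A M]
  [AddCommGroup N] [Module A N]

variable (M) in
/-- The trace `A e_k M` of `P(k)` in `M`. -/
def trace (k : ι) : Submodule A M := Submodule.span A (Set.range fun x : M => e k • x)

variable {e}

theorem smul_mem_trace (k : ι) (x : M) : e k • x ∈ trace e M k :=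
  Submodule.subset_span ⟨x, rfl⟩

theorem trace_le {k : ι} {U : Submodule A M} : trace e M k ≤ U ↔ ∀ x : M, e k • x ∈ U := by
  rw [trace, Submodule.span_le]
  exact ⟨fun h x => h ⟨x, rfl⟩, by rintro h _ ⟨x, rfl⟩; exact h x⟩

theorem map_trace_le (f : M →ₗ[A] N) (k : ι) : (trace e M k).map f ≤ trace e N k := by
  rw [Submodule.map_le_iff_le_comap, trace_le]
  intro x
  rw [Submodule.mem_comap, map_smul]
  exact smul_mem_trace k _

theorem map_trace_of_surjective (f : M →ₗ[A] N) (hf : Function.Surjective f) (k : ι) :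
    (trace e M k).map f = trace e N k := by
  refine (map_trace_le f k).antisymm (trace_le.2 fun y => ?_)
  obtain ⟨x, rfl⟩ := hf y
  exact ⟨_, smul_mem_trace k x, map_smul f _ _⟩

variable (e M) in
/-- The largest submodule of `M` that is annihilated by `e k`. -/
def reject (k : ι) : Submodule A M where
  carrier := {x | ∀ a : A, e k • a • x = 0}
  add_mem' hx hy a := by rw [smul_add, smul_add, hx a, hy a, add_zero]
  zero_mem' a := by rw [smul_zero, smul_zero]
  smul_mem' b x hx a := by rw [smul_smul a b, hx]

theorem mem_reject {k : ι} {x : M} : x ∈ reject e M k ↔ ∀ a : A, e k • a • x = 0 := Iff.rfl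

theorem smul_eq_zero_of_mem_reject {k : ι} {x : M} (h : x ∈ reject e M k) : e k • x = 0 := by
  simpa using h 1

theorem le_reject {k : ι} {U : Submodule A M} :
    U ≤ reject e M k ↔ ∀ x ∈ U, e k • x = 0 :=
  ⟨fun h _ hx => smul_eq_zero_of_mem_reject (h hx), fun h _ hx a => h _ (U.smul_mem a hx)⟩

theorem map_mem_reject (f : M →ₗ[A] N) {k : ι} {x : M} (hx : x ∈ reject e M k) :
    f x ∈ reject e N k := fun a => by rw [← map_smul, ← map_smul, hx, map_zero]

end TraceReject

/-! ### Homomorphisms out of the projectives -/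

section Projective

variable {A : Type*} [Ring A] {ι : Type*} {e : ι → A} {M N : Type*} [AddCommGroup M] [Module A M]
  [AddCommGroup N] [Module A N]

theorem mem_P {i : ι} (hi : IsIdempotentElem (e i)) {x : A} : x ∈ P e i ↔ x * e i = x := by
  rw [P, Submodule.mem_span_singleton]
  constructor
  · rintro ⟨a, rfl⟩
    rw [smul_eq_mul, mul_assoc, hi]
  · exact fun h => ⟨x, h⟩

variable (e) in
/-- The generator `e i` of `P(i)`. -/
def gen (i : ι) : P e i := ⟨e i, Submodule.mem_span_singleton_self _⟩

variable (e) in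
/-- The homomorphism `P(i) → M` given by `a ↦ a x`. -/
def homP (i : ι) (x : M) : P e i →ₗ[A] M := (LinearMap.toSpanSingleton A M x).comp (P e i).subtype

theorem homP_apply (i : ι) (x : M) (a : P e i) : homP e i x a = (a : A) • x := rfl

theorem homP_gen (i : ι) (x : M) : homP e i x (gen e i) = e i • x := rfl

theorem smul_gen {i : ι} (hi : IsIdempotentElem (e i)) (x : P e i) : (x : A) • gen e i = x :=
  Subtype.ext ((mem_P hi).1 x.2)

theorem idem_smul_gen {i : ι} (hi : IsIdempotentElem (e i)) : e i • gen e i = gen e i :=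
  smul_gen hi (gen e i)

theorem gen_mem_iff {i : ι} (hi : IsIdempotentElem (e i)) {U : Submodule A (P e i)} :
    gen e i ∈ U ↔ U = ⊤ := by
  constructor
  · rw [Submodule.eq_top_iff']
    intro h x
    rw [← smul_gen hi x]
    exact U.smul_mem _ h
  · rintro rfl
    trivial

theorem gen_ne_zero {i : ι} (h : e i ≠ 0) : gen e i ≠ 0 := fun h0 => h (congrArg Subtype.val h0)

theorem trace_P_self {i : ι} (hi : IsIdempotentElem (e i)) : trace e (P e i) i = ⊤ := by
  rw [← gen_mem_iff hi]
  conv => rw [← idem_smul_gen hi]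
  exact smul_mem_trace i _

/-- Nakayama: a proper range lies in a maximal submodule, which also contains the radical. -/
theorem range_le_of_surjective [Module.Finite A M] (f : N →ₗ[A] M)
    (h : Function.Surjective ((Module.jacobson A M).mkQ ∘ₗ f)) : Function.Surjective f := by
  rw [← LinearMap.range_eq_top]
  by_contra hne
  obtain ⟨C, hC, hle⟩ := (eq_top_or_exists_le_coatom (LinearMap.range f)).resolve_left hne
  refine hC.1 ((Submodule.eq_top_iff').2 fun x => ?_)
  obtain ⟨y, hy⟩ := h ((Module.jacobson A M).mkQ x)
  have h1 : x - f y ∈ Module.jacobson A M := by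
    rw [← Submodule.Quotient.mk_eq_zero, ← Submodule.mkQ_apply, map_sub, ← hy]
    exact sub_self _
  have h2 : x - f y ∈ C := (sInf_le hC : Module.jacobson A M ≤ C) h1
  have := C.add_mem h2 (hle ⟨y, rfl⟩)
  rwa [sub_add_cancel] at this

theorem exists_surjective_of_top [Module.Finite A M] {i : ι} (hi : IsIdempotentElem (e i))
    (φ : Top A M ≃ₗ[A] S e i) : ∃ f : P e i →ₗ[A] M, Function.Surjective f := by
  obtain ⟨x, hx⟩ := Submodule.mkQ_surjective _ (φ.symm (Submodule.mkQ _ (gen e i)))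
  refine ⟨homP e i x, range_le_of_surjective _ fun y => ?_⟩
  obtain ⟨z, hz⟩ := Submodule.mkQ_surjective _ (φ y)
  refine ⟨z, ?_⟩
  rw [LinearMap.comp_apply, homP_apply, map_smul, hx, ← map_smul, ← map_smul, smul_gen hi, hz,
    LinearEquiv.symm_apply_apply]

theorem homP_comp {i k : ι} (a : P e i) (b : P e k) (x : M) :
    (homP e k x) (homP e i b a) = homP e i ((b : A) • x) a := mul_smul _ _ _

end Projective

/-! ### Locality of the indecomposable projectives -/

section Local

variable {A : Type*} [Ring A] {ι : Type*} [Fintype ι] {e : ι → A}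
  (he : IsBasicFamily e)
include he

/-- The components of `e i` in the two summands are orthogonal idempotents with sum `e i`, so
primitivity kills one of them. -/
theorem IsBasicFamily.eq_bot_of_isCompl {i : ι} {U V : Submodule A (P e i)} (h : IsCompl U V) :
    U = ⊥ ∨ V = ⊥ := by
  have hi := he.complete.idem i
  obtain ⟨x, hx, y, hy, hxy⟩ := Submodule.mem_sup.1
    (show gen e i ∈ U ⊔ V by rw [h.sup_eq_top]; trivial)
  have hdisj : ∀ z ∈ U, z ∈ V → z = 0 := fun z h1 h2 =>
    (Submodule.mem_bot A).1 (h.inf_eq_bot ▸ Submodule.mem_inf.2 ⟨h1, h2⟩)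
  have hsplit : ∀ z : P e i, (z : A) • x + (z : A) • y = z := fun z => by
    rw [← smul_add, hxy, smul_gen hi]
  have hU : ∀ z ∈ U, (z : A) • y = 0 := fun z hz => hdisj _
    (by rw [eq_sub_iff_add_eq'.2 (hsplit z)]; exact U.sub_mem hz (U.smul_mem _ hx))
    (V.smul_mem _ hy)
  have hV : ∀ z ∈ V, (z : A) • x = 0 := fun z hz => hdisj _ (U.smul_mem _ hx)
    (by rw [eq_sub_iff_add_eq.2 (hsplit z)]; exact V.sub_mem hz (V.smul_mem _ hy))
  have hxx : (x : A) • x = x := by simpa [hU x hx] using hsplit x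
  have hyy : (y : A) • y = y := by simpa [hV y hy] using hsplit y
  rcases he.primitive i x y (congrArg Subtype.val hxx) (congrArg Subtype.val hyy)
    (congrArg Subtype.val (hU x hx)) (congrArg Subtype.val (hV y hy))
    (congrArg Subtype.val hxy) with h0 | h0
  · left
    rw [Submodule.eq_bot_iff]
    intro z hz
    rw [← hsplit z, hU z hz, show x = 0 from Subtype.ext h0, smul_zero, zero_add]
  · right
    rw [Submodule.eq_bot_iff]
    intro z hz
    rw [← hsplit z, hV z hz, show y = 0 from Subtype.ext h0, smul_zero, zero_add]

/-- Fitting's lemma: the kernel and range of a high power are complementary. -/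
theorem IsBasicFamily.isNilpotent_or_isUnit [IsArtinianRing A] {i : ι}
    (f : Module.End A (P e i)) : IsNilpotent f ∨ IsUnit f := by
  obtain ⟨n, hn, hn0⟩ := (f.eventually_isCompl_ker_pow_range_pow.and
    (Filter.eventually_gt_atTop 0)).exists
  rcases he.eq_bot_of_isCompl hn with h | h
  · right
    have hb : IsUnit (f ^ n) := by
      rw [Module.End.isUnit_iff]
      refine ⟨LinearMap.ker_eq_bot.1 h, LinearMap.range_eq_top.1 ?_⟩
      simpa [h] using hn.sup_eq_top
    exact (isUnit_pow_iff hn0.ne').1 hb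
  · left
    exact ⟨n, LinearMap.range_eq_bot.1 h⟩

/-- Splitting the generator as `x + y` writes the identity as a sum of two endomorphisms, one of
which must be invertible. -/
theorem IsBasicFamily.eq_top_of_sup_eq_top [IsArtinianRing A] {i : ι} {U V : Submodule A (P e i)}
    (h : U ⊔ V = ⊤) : U = ⊤ ∨ V = ⊤ := by
  have hi := he.complete.idem i
  obtain ⟨x, hx, y, hy, hxy⟩ := Submodule.mem_sup.1
    (show gen e i ∈ U ⊔ V by rw [h]; trivial)
  have key : ∀ (W : Submodule A (P e i)), ∀ z ∈ W, IsUnit (homP e i z) → W = ⊤ := by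
    intro W z hz hu
    obtain ⟨t, ht⟩ := ((Module.End.isUnit_iff _).1 hu).2 (gen e i)
    rw [← gen_mem_iff hi, ← ht]
    exact W.smul_mem _ hz
  have hsum : homP e i x + homP e i y = 1 := by
    ext z : 1
    rw [LinearMap.add_apply, homP_apply, homP_apply, ← smul_add, hxy, smul_gen hi]
    rfl
  rcases he.isNilpotent_or_isUnit (homP e i x) with hn | hu
  · right
    refine key V y hy ?_
    rw [← sub_eq_of_eq_add' hsum.symm]
    exact hn.isUnit_one_sub
  · exact Or.inl (key U x hx hu)

theorem IsBasicFamily.isSimpleModule_S [IsArtinianRing A] (i : ι) : IsSimpleModule A (S e i) := by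
  have hnt : Nontrivial (P e i) := ⟨gen e i, 0, gen_ne_zero (he.ne_zero i)⟩
  obtain ⟨C, hC⟩ := IsCoatomic.exists_coatom (Submodule A (P e i))
  have : Module.jacobson A (P e i) = C := by
    refine le_antisymm (sInf_le hC) (le_sInf fun B (hB : IsCoatom B) => ?_)
    by_contra hCB
    rcases he.eq_top_of_sup_eq_top (hB.2 _ (right_lt_sup.2 hCB)) with h | h
    · exact hC.1 h
    · exact hB.1 h
  rw [isSimpleModule_iff_isCoatom, this]
  exact hC

/-- Elements of `A` carrying `x'` to `y'` and back give maps between `P(i)` and `P(k)` whose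
composites are invertible; basicness then gives `i = k`. -/
theorem IsBasicFamily.eq_of_isSimpleModule [IsArtinianRing A] {T : Type*} [AddCommGroup T]
    [Module A T] [IsSimpleModule A T] {i k : ι} {x y : T} (hx : e i • x ≠ 0) (hy : e k • y ≠ 0) :
    i = k := by
  have hi := he.complete.idem i
  have hk := he.complete.idem k
  set x' := e i • x
  set y' := e k • y
  have hx' : e i • x' = x' := by rw [← mul_smul, hi]
  have hy' : e k • y' = y' := by rw [← mul_smul, hk]
  obtain ⟨a, ha⟩ := (LinearMap.range_eq_top.1 (IsSimpleModule.span_singleton_eq_top A hx ▸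
    LinearMap.range_toSpanSingleton x')) y'
  obtain ⟨b, hb⟩ := (LinearMap.range_eq_top.1 (IsSimpleModule.span_singleton_eq_top A hy ▸
    LinearMap.range_toSpanSingleton y')) x'
  simp only [LinearMap.toSpanSingleton_apply] at ha hb
  have hib : e i * b * e k ∈ P e k := Submodule.smul_mem _ (e i * b) (gen e k).2
  have hka : e k * a * e i ∈ P e i := Submodule.smul_mem _ (e k * a) (gen e i).2
  have hb' : (e i * b * e k) • y' = x' := by rw [mul_smul, hy', mul_smul, hb, hx']
  have ha' : (e k * a * e i) • x' = y' := by rw [mul_smul, hx', mul_smul, ha, hy']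
  -- An endomorphism compatible with a nonzero map `P(l) → T` cannot be nilpotent, since its powers
  -- stay compatible.
  have hnn : ∀ {l : ι} (z : T), z ≠ 0 → e l • z = z → ∀ f : Module.End A (P e l),
      (∀ p, homP e l z (f p) = homP e l z p) → IsUnit f := by
    intro l z hz hlz f hf
    refine (he.isNilpotent_or_isUnit f).resolve_left ?_
    rintro ⟨n, hn⟩
    have : ∀ n p, homP e l z ((f ^ n) p) = homP e l z p := by
      intro n
      induction n with
      | zero => exact fun p => rfl
      | succ n ih =>
        intro p
        rw [pow_succ, Module.End.mul_apply, ih, hf]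
    have h0 := this n (gen e l)
    rw [hn, LinearMap.zero_apply, map_zero, homP_gen, hlz] at h0
    exact hz h0.symm
  let f := homP e i (⟨_, hib⟩ : P e k)
  let g := homP e k (⟨_, hka⟩ : P e i)
  have h1 : IsUnit (g ∘ₗ f : Module.End A (P e i)) := hnn x' hx hx' _ fun p => by
    change homP e i x' (homP e k _ (homP e i _ p)) = _
    rw [homP_comp, homP_comp, ha', hb']
  have h2 : IsUnit (f ∘ₗ g : Module.End A (P e k)) := hnn y' hy hy' _ fun p => by
    change homP e k y' (homP e i _ (homP e k _ p)) = _
    rw [homP_comp, homP_comp, hb', ha']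
  have hf : Function.Bijective f :=
    ⟨Function.Injective.of_comp (f := g) ((Module.End.isUnit_iff _).1 h1).1,
      Function.Surjective.of_comp (g := g) ((Module.End.isUnit_iff _).1 h2).2⟩
  exact he.basic i k ⟨LinearEquiv.ofBijective f hf⟩

end Local

/-! ### Homomorphisms into the injectives and duality of dimensions -/

section Injective

variable {K : Type v} [Field K] {A : Type u} [Ring A] [Algebra K A] {ι : Type*} {e : ι → A}
  {M : Type*} [AddCommGroup M] [Module K M] [Module A M] [IsScalarTower K A M]

theorem reject_I_self (i : ι) : reject e (I K e i) i = ⊥ := by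
  rw [Submodule.eq_bot_iff]
  intro f hf
  refine Subtype.ext (D.ext fun x => ?_)
  have h : (f : D K A) (1 * e i * x) = 0 := congrArg (fun g : I K e i => (g : D K A) 1) (hf x)
  rwa [one_mul, f.2 x] at h

theorem reject_eq_bot_of_injective_I {i : ι} {N : Type*} [AddCommGroup N] [Module A N]
    (f : N →ₗ[A] I K e i) (hf : Function.Injective f) : reject e N i = ⊥ := by
  rw [Submodule.eq_bot_iff]
  intro x hx
  have := map_mem_reject f hx
  rw [reject_I_self, Submodule.mem_bot] at this
  exact hf (this.trans (map_zero f).symm)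

/-- The homomorphism `M → I(i)` given by a functional on `M`. -/
def toI {i : ι} (hi : IsIdempotentElem (e i)) (φ : Module.Dual K M) : M →ₗ[A] I K e i where
  toFun n := ⟨φ ∘ₗ (LinearMap.toSpanSingleton A M n).restrictScalars K ∘ₗ LinearMap.mulLeft K (e i),
    fun x => congrArg (fun y : A => φ (y • n)) (show e i * (e i * x) = e i * x by
      rw [← mul_assoc, hi])⟩
  map_add' x y := Subtype.ext (D.ext fun a => by
    change φ ((e i * a) • (x + y)) = φ ((e i * a) • x) + φ ((e i * a) • y)
    rw [smul_add, map_add])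
  map_smul' b x := Subtype.ext (D.ext fun a => by
    change φ ((e i * a) • b • x) = φ ((e i * (a * b)) • x)
    rw [smul_smul, mul_assoc])

theorem toI_apply {i : ι} (hi : IsIdempotentElem (e i)) (φ : Module.Dual K M) (x : M) (a : A) :
    (toI hi φ x : D K A) a = φ (e i • a • x) := congrArg φ (mul_smul (e i) a x)

/-- Take a functional that is nonzero on `e_i t` for some `t` in the socle. A nonzero kernel of the
induced map would contain a simple submodule, hence the whole simple socle, hence `t`. -/
theorem exists_injective_of_socle [FiniteDimensional K M] [IsArtinian A M] {i : ι}
    (hi : IsIdempotentElem (e i))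
    (hS : IsSimpleModule A (S e i)) (φ : socle A M ≃ₗ[A] S e i) :
    ∃ f : M →ₗ[A] I K e i, Function.Injective f := by
  have hT : IsSimpleModule A (socle A M) := IsSimpleModule.congr φ
  have hgen : e i • (Submodule.mkQ _ (gen e i) : S e i) = Submodule.mkQ _ (gen e i) := by
    rw [← map_smul, idem_smul_gen hi]
  obtain ⟨t, ht, ht0⟩ : ∃ t ∈ socle A M, e i • t ≠ 0 := by
    by_contra! h
    have h0 : (Submodule.mkQ _ (gen e i) : S e i) = 0 := by
      rw [← hgen, ← φ.apply_symm_apply (Submodule.mkQ _ (gen e i)), ← map_smul]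
      rw [φ.map_eq_zero_iff]
      exact Subtype.ext (h _ (φ.symm _).2)
    have := hS.nontrivial
    obtain ⟨y, hy⟩ := exists_ne (0 : S e i)
    obtain ⟨x, rfl⟩ := Submodule.mkQ_surjective _ y
    exact hy (by rw [← smul_gen hi x, map_smul, h0, smul_zero])
  obtain ⟨ψ, hψ⟩ : ∃ ψ : Module.Dual K M, ψ (e i • t) ≠ 0 := by
    by_contra! h
    exact ht0 ((Module.forall_dual_apply_eq_zero_iff K _).1 h)
  refine ⟨toI hi ψ, ?_⟩
  rw [← LinearMap.ker_eq_bot]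
  by_contra hne
  obtain ⟨U, hU, hle⟩ := (eq_bot_or_exists_atom_le _).resolve_left hne
  have hUs : U ≤ socle A M := le_sSup (isSimpleModule_iff_isAtom.2 hU)
  have hUeq : U = socle A M :=
    ((isSimpleModule_iff_isAtom.1 hT).le_iff.1 hUs).resolve_left hU.1
  have h0 : toI hi ψ t = 0 := hle (hUeq ▸ ht)
  have := toI_apply hi ψ t 1
  rw [h0, one_smul] at this
  exact hψ this.symm

/-- Pulling back along `x ↦ e_k x e_m` embeds the dual of `e_k P(m)` in `e_m I(k)`. -/
theorem mult_P_le_mult_I [FiniteDimensional K A] {k m : ι} (hk : IsIdempotentElem (e k))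
    (hm : IsIdempotentElem (e m)) : mult K e (P e m) k ≤ mult K e (I K e k) m := by
  have : FiniteDimensional K (P e m) := finiteDimensional_submodule _
  have : FiniteDimensional K (I K e k) := finiteDimensional_submodule _
  have hmem : ∀ x : A, (e k * x) • gen e m ∈ smulRange K (P e m) (e k) := fun x =>
    ⟨x • gen e m, (mul_smul _ _ _).symm⟩
  let ρ : A →ₗ[K] smulRange K (P e m) (e k) := ((LinearMap.toSpanSingleton A (P e m)
    (gen e m)).restrictScalars K ∘ₗ LinearMap.mulLeft K (e k)).codRestrict _ hmem
  have hρ : Function.Surjective ρ := by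
    rintro ⟨_, x, rfl⟩
    refine ⟨x, Subtype.ext ?_⟩
    change (e k * (x : A)) • gen e m = e k • x
    rw [mul_smul, smul_gen hm]
  have hρm : ∀ x, ρ (x * e m) = ρ x := fun x => Subtype.ext (Subtype.ext (by
    change e k * (x * e m) * e m = e k * x * e m
    rw [mul_assoc, mul_assoc, hm, mul_assoc]))
  have hρk : ∀ x, ρ (e k * x) = ρ x := fun x => Subtype.ext (Subtype.ext (by
    change e k * (e k * x) * e m = e k * x * e m
    rw [← mul_assoc (e k) (e k), hk]))
  let F : Module.Dual K (smulRange K (P e m) (e k)) →ₗ[K] smulRange K (I K e k) (e m) :=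
    { toFun := fun ψ => ⟨⟨ψ ∘ₗ ρ, fun x => congrArg ψ (hρk x)⟩, (mem_smulRange hm).2
        (Subtype.ext (D.ext fun x => congrArg ψ (hρm x)))⟩
      map_add' := fun _ _ => rfl
      map_smul' := fun _ _ => rfl }
  have hF : Function.Injective F := fun ψ ψ' h => LinearMap.ext fun y => by
    obtain ⟨x, rfl⟩ := hρ y
    exact congrArg (fun g : smulRange K (I K e k) (e m) => ((g : I K e k) : D K A) x) h
  have := LinearMap.finrank_le_finrank_of_injective hF
  rwa [Subspace.dual_finrank_eq] at this

/-- Functionals in `e_m W` vanish on `Q` and are determined by their values on `e_k A e_m`, so they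
embed in the dual of `e_k (P(m)/Q)`. -/
theorem mult_le_of_forall_eq_zero [FiniteDimensional K A] {k m : ι} (hm : IsIdempotentElem (e m))
    {Q : Submodule A (P e m)} {W : Submodule A (I K e k)}
    (h : ∀ f ∈ W, ∀ x ∈ Q, (f : D K A) (x : A) = 0) :
    mult K e W m ≤ mult K e (P e m ⧸ Q) k := by
  have : FiniteDimensional K (P e m) := finiteDimensional_submodule _
  let L : W →ₗ[K] Module.Dual K (P e m ⧸ Q) :=
    { toFun := fun f => (Submodule.liftQ (Q.restrictScalars K)
        ((show Module.Dual K A from ((f : I K e k) : D K A)) ∘ₗ (P e m).subtype.restrictScalars K)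
        fun x hx => h f f.2 x hx) ∘ₗ
          (Submodule.Quotient.restrictScalarsEquiv K Q).symm.toLinearMap
      map_add' := fun f g => LinearMap.ext fun y => by
        obtain ⟨x, rfl⟩ := Submodule.mkQ_surjective _ y
        rfl
      map_smul' := fun c f => LinearMap.ext fun y => by
        obtain ⟨x, rfl⟩ := Submodule.mkQ_surjective _ y
        rfl }
  have hL : ∀ (f : W) (x : P e m), L f (Q.mkQ x) = ((f : I K e k) : D K A) (x : A) :=
    fun f x => rfl
  let F : smulRange K W (e m) →ₗ[K] Module.Dual K (smulRange K (P e m ⧸ Q) (e k)) :=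
    (smulRange K (P e m ⧸ Q) (e k)).dualRestrict ∘ₗ L ∘ₗ (smulRange K W (e m)).subtype
  have hF : Function.Injective F := by
    rw [injective_iff_map_eq_zero]
    rintro ⟨f, hf⟩ h0
    refine Subtype.ext (Subtype.ext (Subtype.ext (D.ext fun x => ?_)))
    have hfm : ∀ y, ((f : I K e k) : D K A) (y * e m) = ((f : I K e k) : D K A) y := fun y =>
      congrArg (fun g : W => ((g : I K e k) : D K A) y) ((mem_smulRange hm).1 hf)
    have h1 : L f (Q.mkQ (e k • x • gen e m)) = 0 :=
      congrArg (fun g : Module.Dual K (smulRange K (P e m ⧸ Q) (e k)) =>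
        g ⟨Q.mkQ (e k • x • gen e m), Q.mkQ (x • gen e m), (map_smul _ _ _).symm⟩) h0
    rw [hL] at h1
    change ((f : I K e k) : D K A) (e k * (x * e m)) = 0 at h1
    rwa [(f : I K e k).2, hfm] at h1
  have := LinearMap.finrank_le_finrank_of_injective hF
  rwa [Subspace.dual_finrank_eq] at this

end Injective

theorem fin_eq_sum_of_succ {r : ℕ} (f : Fin (r + 1) → ℕ) (d : Fin r → ℕ) (h0 : f 0 = 0)
    (hs : ∀ k : Fin r, f k.succ = d k + f k.castSucc) : f (Fin.last r) = ∑ k, d k := by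
  induction r with
  | zero => simpa using h0
  | succ r ih =>
    rw [Fin.sum_univ_castSucc, ← ih (fun k => f k.castSucc) (fun k => d k.castSucc) h0
      fun k => hs k.castSucc, ← Fin.succ_last, hs, add_comm]

/-! ### Dimensions of the standard and projective modules -/

section Standard

variable {K : Type v} [Field K] {A : Type u} [Ring A] [Algebra K A] [FiniteDimensional K A]
  {ι : Type w} [PartialOrder ι] {e : ι → A}

theorem smul_std_eq_zero {i m : ι} (h : ¬ m ≤ i) (x : Std K e i) : e m • x = 0 :=
  (mult_eq_zero_iff K e _ m).1 ((stdKer_isLeast K e i).1 m h) x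

theorem smul_costd_eq_zero {i m : ι} (h : ¬ m ≤ i) (x : Costd K e i) : e m • x = 0 :=
  (mult_eq_zero_iff K e _ m).1 ((costd_isGreatest K e i).1 m h) x

variable [BoundedOrder ι] (hA : IsOneQuasiHereditary K e)

include hA in
open Classical in
theorem IsOneQuasiHereditary.mult_std_eq (i m : ι) :
    mult K e (Std K e i) m = if m ≤ i then 1 else 0 := by
  split_ifs with h
  · exact hA.mult_std i m h
  · exact (stdKer_isLeast K e i).1 m h

include hA in
theorem IsOneQuasiHereditary.std_injective {i k : ι} (φ : Std K e i ≃ₗ[A] Std K e k) : i = k := by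
  have h1 := mult_congr (K := K) (e := e) φ i
  have h2 := mult_congr (K := K) (e := e) φ k
  rw [hA.mult_std_eq, hA.mult_std_eq, if_pos le_rfl] at h1 h2
  refine le_antisymm ?_ ?_
  · by_contra h
    rw [if_neg h] at h1
    exact one_ne_zero h1
  · by_contra h
    rw [if_neg h] at h2
    exact one_ne_zero h2.symm

omit [FiniteDimensional K A] in
include hA in
open Classical in
-- `filtMult` always evaluates the same chosen filtration, so one filtration realizes all the
-- multiplicities at once.
theorem IsOneQuasiHereditary.exists_filtration (j : ι) :
    ∃ F : GoodFiltration A (Std K e) (P e j), ∀ i, F.count i = if j ≤ i then 1 else 0 := by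
  refine ⟨(hA.deltaGood j).some, fun i => ?_⟩
  have h : deltaMult K e (P e j) i = (hA.deltaGood j).some.count i := by
    rw [deltaMult, filtMult]
    exact dif_pos (hA.deltaGood j)
  rw [← h]
  split_ifs with hij
  · exact hA.deltaMult_proj i j hij
  · exact hA.deltaMult_eq_zero j i hij

include hA in
open Classical in
theorem IsOneQuasiHereditary.card_index {j : ι} {F : GoodFiltration A (Std K e) (P e j)}
    (hF : ∀ i, F.count i = if j ≤ i then 1 else 0) (idx : Fin F.length → ι)
    (hidx : ∀ k, Nonempty (Subquot (F.filt k.succ) (F.filt k.castSucc) ≃ₗ[A] Std K e (idx k)))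
    (i : ι) : (Finset.univ.filter fun k => idx k = i).card = if j ≤ i then 1 else 0 := by
  rw [← hF i, GoodFiltration.count, Nat.card_eq_fintype_card, Fintype.card_subtype]
  congr 1
  ext k
  simp only [Finset.mem_filter, Finset.mem_univ, true_and]
  obtain ⟨φ⟩ := hidx k
  constructor
  · rintro rfl
    exact ⟨φ⟩
  · rintro ⟨ψ⟩
    exact hA.std_injective (φ.symm.trans ψ)

variable [Fintype ι]

open Classical in
/-- The vertices above `j`. -/
noncomputable def up (j : ι) : Finset ι := Finset.univ.filter (j ≤ ·)

omit [BoundedOrder ι] in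
theorem mem_up {i j : ι} : i ∈ up j ↔ j ≤ i := by simp [up]

omit [BoundedOrder ι] in
theorem isUpperSet_up (j : ι) : IsUpperSet (up j : Set ι) := fun a b hab ha => by
  simp only [Finset.mem_coe, mem_up] at ha ⊢
  exact ha.trans hab

variable (he : CompleteOrthogonalIdempotents e)
include hA he

theorem IsOneQuasiHereditary.mult_P (j m : ι) :
    mult K e (P e j) m = ∑ l ∈ up j, mult K e (Std K e l) m := by
  classical
  obtain ⟨F, hF⟩ := hA.exists_filtration j
  choose idx hidx using F.subquot
  have h1 : mult K e (F.filt (Fin.last _)) m = ∑ k, mult K e (Std K e (idx k)) m := by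
    refine fin_eq_sum_of_succ (fun k => mult K e (F.filt k) m) _ ?_ fun k => ?_
    · rw [mult_eq_zero_iff]
      rintro ⟨x, hx⟩
      rw [F.bot, Submodule.mem_bot] at hx
      subst hx
      exact smul_zero _
    · obtain ⟨φ⟩ := hidx k
      obtain ⟨f, hf, hk⟩ := exists_of_subquotEquiv φ
      exact mult_eq_add_of_subquot (he.idem m) (F.mono (Fin.castSucc_lt_succ).le) f hf hk
  rw [F.top, mult_congr Submodule.topEquiv] at h1
  rw [h1, ← Finset.sum_fiberwise_of_maps_to (t := Finset.univ) (g := idx)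
    (fun k _ => Finset.mem_univ _), up, Finset.sum_filter]
  refine Finset.sum_congr rfl fun i _ => ?_
  rw [Finset.sum_congr rfl fun k hk => by rw [(Finset.mem_filter.1 hk).2], Finset.sum_const,
    hA.card_index hF idx hidx]
  split_ifs <;> simp

theorem IsOneQuasiHereditary.mult_P_of_le {j m : ι} (h : j ≤ m) :
    mult K e (P e j) m = (up m).card := by
  classical
  rw [hA.mult_P he, up, up, Finset.card_filter, Finset.sum_filter]
  refine Finset.sum_congr rfl fun l _ => ?_
  rw [hA.mult_std_eq]
  by_cases hl : m ≤ l
  · rw [if_pos (h.trans hl)]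
  · rw [if_neg hl, ite_self]

theorem IsOneQuasiHereditary.mult_P_of_ge {j m : ι} (h : m ≤ j) :
    mult K e (P e j) m = (up j).card := by
  classical
  rw [hA.mult_P he, Finset.card_eq_sum_ones]
  refine Finset.sum_congr rfl fun l hl => ?_
  rw [hA.mult_std_eq, if_pos (h.trans (mem_up.1 hl))]

/-- It suffices that `e_m` kills `P(k)/V` for `m ≰ k`. This is checked by climbing a good filtration
of `P(k)`. -/
theorem IsOneQuasiHereditary.stdKer_le (k : ι) :
    stdKer K e k ≤ ⨆ l > k, trace e (P e k) l := by
  classical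
  set V := ⨆ l > k, trace e (P e k) l
  refine sInf_le fun m hm => (mult_eq_zero_iff K e _ m).2 fun x => ?_
  obtain ⟨x, rfl⟩ := V.mkQ_surjective x
  rw [← map_smul, Submodule.mkQ_apply, Submodule.Quotient.mk_eq_zero]
  obtain ⟨F, hF⟩ := hA.exists_filtration k
  have key : ∀ s, ∀ x ∈ F.filt s, e m • x ∈ V := by
    intro s
    induction s using Fin.induction with
    | zero =>
      intro x hx
      rw [F.bot, Submodule.mem_bot] at hx
      rw [hx, smul_zero]
      exact V.zero_mem
    | succ s ih =>
      intro x hx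
      choose idx hidx using F.subquot
      obtain ⟨φ⟩ := hidx s
      obtain ⟨f, hf, hk⟩ := exists_of_subquotEquiv φ
      have hidem : e m • e m • x = e m • x := by rw [← mul_smul, he.idem m]
      -- A factor `Δ(k)` is killed by `e_m`; any other factor is some `Δ(l)` with `l > k`, generated
      -- by the image of an element of the form `e_l y`.
      rcases eq_or_ne (idx s) k with h | h
      · rw [← hidem]
        refine ih _ ((hk ⟨e m • x, Submodule.smul_mem _ _ hx⟩).1 ?_)
        exact (map_smul f (e m) ⟨x, hx⟩).trans (smul_std_eq_zero (by rwa [h]) _)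
      · have hlt : k < idx s := by
          refine lt_of_le_of_ne ?_ (Ne.symm h)
          by_contra hle
          have := hA.card_index hF idx hidx (idx s)
          rw [if_neg hle, Finset.card_eq_zero] at this
          exact Finset.notMem_empty s (this ▸ Finset.mem_filter.2 ⟨Finset.mem_univ _, rfl⟩)
        obtain ⟨p, hp⟩ := (stdKer K e (idx s)).mkQ_surjective (f ⟨x, hx⟩)
        obtain ⟨y, hy⟩ := hf ((stdKer K e (idx s)).mkQ (gen e (idx s)))
        -- This element has the same image as `x` in the factor but lies in the trace of `P(idx s)`,
        -- so only `x - y'`, one level lower, remains.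
        set y' := (p : A) • e (idx s) • y with hy'
        have h1 : f ⟨x, hx⟩ = f y' := by
          rw [hy', map_smul, map_smul, hy, ← map_smul, ← map_smul, idem_smul_gen (he.idem _),
            smul_gen (he.idem _), hp]
        have h2 : x - y' ∈ F.filt s.castSucc := by
          refine (hk (⟨x, hx⟩ - y')).1 ?_
          rw [map_sub, h1, sub_self]
        have h3 : (y' : P e k) ∈ V := (le_iSup₂ (f := fun l (_ : l > k) => trace e (P e k) l)
          (idx s) hlt) (Submodule.smul_mem _ _ (smul_mem_trace _ _))
        have := V.add_mem (ih _ h2) (V.smul_mem (e m) h3)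
        rwa [← smul_add, sub_add_cancel] at this
  exact key (Fin.last _) x (by rw [F.top]; trivial)

end Standard

/-! ### Copies of `P(i)` as traces, kernels as rejects -/

section OneQuasiHereditary

variable {K : Type v} [Field K] {A : Type u} [Ring A] [Algebra K A] [FiniteDimensional K A]
  {ι : Type w} [Fintype ι] [PartialOrder ι] [BoundedOrder ι] {e : ι → A}

variable (he : IsBasicFamily e) (hA : IsOneQuasiHereditary K e)
include he hA

theorem IsOneQuasiHereditary.exists_surjective_I (i : ι) :
    ∃ g : P e ⊥ →ₗ[A] I K e i, Function.Surjective g := by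
  obtain ⟨φ⟩ := hA.top_inj i
  have : Module.Finite A (I K e i) := Module.Finite.of_restrictScalars_finite K A _
  exact exists_surjective_of_top (he.complete.idem ⊥) φ

/-- Both `[P(1):S(i)]` and the lower bound `[P(i):S(j)]` for `[I(j):S(i)]` equal the number of
vertices above `i`, so `S(i)` does not occur in the kernel. -/
theorem IsOneQuasiHereditary.ker_le_reject {i j : ι} (h : j ≤ i) {g : P e ⊥ →ₗ[A] I K e j}
    (hg : Function.Surjective g) : LinearMap.ker g ≤ reject e (P e ⊥) i := by
  have hi := he.complete.idem i
  have h1 := mult_eq_add_ker (K := K) hi g hg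
  have h2 := mult_P_le_mult_I (K := K) (he.complete.idem j) hi
  rw [hA.mult_P_of_le he.complete bot_le] at h1
  rw [hA.mult_P_of_ge he.complete h] at h2
  have h3 := (mult_eq_zero_iff K e (LinearMap.ker g) i).1 (by omega)
  exact le_reject.2 fun x hx => congrArg Subtype.val (h3 ⟨x, hx⟩)

theorem IsOneQuasiHereditary.ker_eq_reject {i : ι} {g : P e ⊥ →ₗ[A] I K e i}
    (hg : Function.Surjective g) : LinearMap.ker g = reject e (P e ⊥) i := by
  refine (hA.ker_le_reject he le_rfl hg).antisymm fun x hx => ?_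
  have := map_mem_reject g hx
  rwa [reject_I_self, Submodule.mem_bot] at this

theorem IsOneQuasiHereditary.reject_mono {i j : ι} (h : j ≤ i) :
    reject e (P e ⊥) j ≤ reject e (P e ⊥) i := by
  obtain ⟨g, hg⟩ := hA.exists_surjective_I he j
  rw [← hA.ker_eq_reject he hg]
  exact hA.ker_le_reject he h hg

theorem IsOneQuasiHereditary.injective_of_surjective_I_bot {g : P e ⊥ →ₗ[A] I K e ⊥}
    (hg : Function.Surjective g) : Function.Injective g := by
  refine injective_of_mult_le (K := K) he.complete g hg fun m => ?_
  have := mult_P_le_mult_I (K := K) (he.complete.idem ⊥) (he.complete.idem m)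
  rwa [hA.mult_P_of_ge he.complete bot_le, ← hA.mult_P_of_le he.complete bot_le] at this

theorem IsOneQuasiHereditary.reject_bot : reject e (P e ⊥) ⊥ = ⊥ := by
  obtain ⟨g, hg⟩ := hA.exists_surjective_I he ⊥
  rw [← hA.ker_eq_reject he hg, LinearMap.ker_eq_bot]
  exact hA.injective_of_surjective_I_bot he hg

/-- The socle `S(1)` embeds `P(j)` in `I(1)`, and `I(1) ≅ P(1)`. -/
theorem IsOneQuasiHereditary.exists_injective_P_bot (j : ι) :
    ∃ f : P e j →ₗ[A] P e ⊥, Function.Injective f := by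
  have : IsArtinianRing A := isArtinian_of_tower K inferInstance
  obtain ⟨g, hg⟩ := hA.exists_surjective_I he ⊥
  obtain ⟨φ⟩ := hA.socle_proj j
  obtain ⟨f, hf⟩ := exists_injective_of_socle (K := K) (he.complete.idem ⊥)
    (he.isSimpleModule_S ⊥) φ
  let γ := LinearEquiv.ofBijective g ⟨hA.injective_of_surjective_I_bot he hg, hg⟩
  exact ⟨γ.symm.toLinearMap ∘ₗ f, γ.symm.injective.comp hf⟩

/-- `P(k)` is generated by its `e_k`-part, and that part already has the dimension of `e_k P(1)`. -/
theorem IsOneQuasiHereditary.range_eq_trace {k : ι} {f : P e k →ₗ[A] P e ⊥}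
    (hf : Function.Injective f) : LinearMap.range f = trace e (P e ⊥) k := by
  have hk := he.complete.idem k
  refine le_antisymm ?_ (trace_le.2 (smul_mem_of_mult_le (K := K) hk ?_))
  · rw [LinearMap.range_eq_map, ← trace_P_self hk]
    exact map_trace_le f k
  · rw [← mult_congr (LinearEquiv.ofInjective f hf), hA.mult_P_of_le he.complete bot_le,
      hA.mult_P_of_le he.complete le_rfl]

theorem IsOneQuasiHereditary.nonempty_trace_equiv {j k : ι} (h : j ≤ k) :
    Nonempty (trace e (P e j) k ≃ₗ[A] P e k) := by
  have hk := he.complete.idem k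
  obtain ⟨f, hf⟩ := hA.exists_injective_P_bot he k
  obtain ⟨g, hg⟩ := hA.exists_injective_P_bot he j
  have key : (trace e (P e j) k).map g = LinearMap.range f := by
    rw [hA.range_eq_trace he hf]
    refine (map_trace_le g k).antisymm (trace_le.2 fun x => ?_)
    obtain ⟨y, hy⟩ : e k • x ∈ LinearMap.range g := by
      refine smul_mem_of_mult_le (K := K) hk ?_ x
      rw [← mult_congr (LinearEquiv.ofInjective g hg), hA.mult_P_of_le he.complete bot_le,
        hA.mult_P_of_le he.complete h]
    exact ⟨_, smul_mem_trace k y, by rw [map_smul, hy, ← mul_smul, hk]⟩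
  exact ⟨((Submodule.equivMapOfInjective g hg _).trans (LinearEquiv.ofEq _ _ key)).trans
    (LinearEquiv.ofInjective f hf).symm⟩

/-- Being generated by its `e_k`-part, `U` lies in the trace; being isomorphic to the trace, it has
the same dimensions. -/
theorem IsOneQuasiHereditary.eq_trace {j k : ι} (h : j ≤ k) {U : Submodule A (P e j)}
    (φ : U ≃ₗ[A] P e k) : U = trace e (P e j) k := by
  obtain ⟨ψ⟩ := hA.nonempty_trace_equiv he h
  refine eq_of_mult_le (K := K) he.complete ?_ fun m =>
    (mult_congr (ψ.trans φ.symm) m).le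
  have h1 : trace e U k = ⊤ := by
    rw [← map_trace_of_surjective φ.symm.toLinearMap φ.symm.surjective,
      trace_P_self (he.complete.idem k), Submodule.map_top]
    exact LinearMap.range_eq_top.2 φ.symm.surjective
  have h2 := map_trace_le (e := e) U.subtype k
  rwa [h1, Submodule.map_subtype_top] at h2

theorem IsOneQuasiHereditary.trace_anti {i j k : ι} (hji : j ≤ i) (hik : i ≤ k) :
    trace e (P e j) k ≤ trace e (P e j) i := by
  obtain ⟨ψ⟩ := hA.nonempty_trace_equiv he hji
  refine trace_le.2 (smul_mem_of_mult_le (K := K) (he.complete.idem k) ?_)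
  rw [mult_congr ψ, hA.mult_P_of_le he.complete (hji.trans hik), hA.mult_P_of_le he.complete hik]

theorem IsOneQuasiHereditary.projSub_eq {j i : ι} (h : j ≤ i) :
    projSub e j i = trace e (P e j) i := by
  refine le_antisymm (sSup_le ?_) (le_sSup (hA.nonempty_trace_equiv he h))
  rintro N ⟨φ⟩
  exact (hA.eq_trace he h φ).le

theorem IsOneQuasiHereditary.kerInj_eq (i : ι) : kerInj K e i = reject e (P e ⊥) i := by
  refine le_antisymm (sSup_le ?_) ?_
  · rintro N ⟨g, hg, rfl⟩
    exact (hA.ker_eq_reject he hg).le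
  · obtain ⟨g, hg⟩ := hA.exists_surjective_I he i
    exact le_sSup ⟨g, hg, (hA.ker_eq_reject he hg).symm⟩

end OneQuasiHereditary

/-! ### Sums of traces -/

section Traces

variable {A : Type u} [Ring A] {ι : Type w} (e : ι → A)

/-- The sum of the traces of the `P(i)` in `P(j)`, for `i` in `Λ`. -/
def traces (j : ι) (Λ : Finset ι) : Submodule A (P e j) := ⨆ i ∈ Λ, trace e (P e j) i

variable {e}

theorem trace_le_traces {j i : ι} {Λ : Finset ι} (h : i ∈ Λ) :
    trace e (P e j) i ≤ traces e j Λ := le_iSup₂ (f := fun i (_ : i ∈ Λ) => trace e (P e j) i) i h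

theorem traces_mono {j : ι} {Λ Λ' : Finset ι} (h : Λ ⊆ Λ') : traces e j Λ ≤ traces e j Λ' :=
  iSup₂_le fun _ hi => trace_le_traces (h hi)

theorem traces_empty (j : ι) : traces e j ∅ = ⊥ := by simp [traces]

theorem traces_eq_sup_erase [DecidableEq ι] {j k : ι} {Λ : Finset ι} (h : k ∈ Λ) :
    traces e j Λ = trace e (P e j) k ⊔ traces e j (Λ.erase k) := by
  conv_lhs => rw [← Finset.insert_erase h]
  rw [traces, Finset.iSup_insert, traces]

end Traces

/-! ### `Δ`-good factor modules of `P(j)` -/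

section DeltaGood

variable {K : Type v} [Field K] {A : Type u} [Ring A] [Algebra K A] [FiniteDimensional K A]
  {ι : Type w} [Fintype ι] [PartialOrder ι] [BoundedOrder ι] {e : ι → A}

variable (he : IsBasicFamily e) (hA : IsOneQuasiHereditary K e)
include he

omit [BoundedOrder ι] in
theorem traces_up (j : ι) : traces e j (up j) = ⊤ :=
  top_le_iff.1 ((trace_P_self (he.complete.idem j)).symm.le.trans
    (trace_le_traces (mem_up.2 le_rfl)))

include hA

open Classical in
-- The trace of `P(k)` covers the subquotient. The kernel of `P(k) → Δ(k)` comes from vertices `l >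
-- k`, which remain in `Λ` after deleting `k`.
theorem IsOneQuasiHereditary.exists_surjective_std {j k : ι} {Λ : Finset ι} (hsub : Λ ⊆ up j)
    (hΛ : IsUpperSet (Λ : Set ι)) (hk : k ∈ Λ) :
    ∃ f : Std K e k →ₗ[A] Subquot (traces e j Λ) (traces e j (Λ.erase k)),
      Function.Surjective f := by
  obtain ⟨φ⟩ := hA.nonempty_trace_equiv he (mem_up.1 (hsub hk))
  let g : P e k →ₗ[A] Subquot (traces e j Λ) (traces e j (Λ.erase k)) :=
    Submodule.mkQ _ ∘ₗ Submodule.inclusion (trace_le_traces hk) ∘ₗ φ.symm.toLinearMap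
  have hg : Function.Surjective g := by
    intro y
    obtain ⟨⟨y, hy⟩, rfl⟩ := Submodule.mkQ_surjective _ y
    obtain ⟨t, ht, z, hz, htz⟩ := Submodule.mem_sup.1 
      ((traces_eq_sup_erase (e := e) (j := j) hk).le hy)
    refine ⟨φ ⟨t, ht⟩, ?_⟩
    refine (Submodule.Quotient.eq _).2 ?_
    change (φ.symm (φ ⟨t, ht⟩) : P e j) - y ∈ traces e j (Λ.erase k)
    rw [φ.symm_apply_apply, ← htz, sub_add_cancel_left]
    exact Submodule.neg_mem _ hz
  refine ⟨Submodule.liftQ _ g ((hA.stdKer_le he.complete k).trans (iSup₂_le fun l hl =>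
    trace_le.2 fun x => ?_)), ?_⟩
  · refine (Submodule.Quotient.mk_eq_zero _).2 ?_
    change ((φ.symm (e l • x) : trace e (P e j) k) : P e j) ∈ traces e j (Λ.erase k)
    rw [map_smul]
    exact trace_le_traces (Finset.mem_erase.2 ⟨hl.ne', hΛ hl.le hk⟩) (smul_mem_trace l _)
  · intro y
    obtain ⟨x, rfl⟩ := hg y
    exact ⟨Submodule.mkQ _ x, rfl⟩

theorem IsOneQuasiHereditary.mult_traces {j : ι} {Λ : Finset ι} (hsub : Λ ⊆ up j)
    (hΛ : IsUpperSet (Λ : Set ι)) (m : ι) :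
    mult K e (traces e j Λ) m = ∑ l ∈ Λ, mult K e (Std K e l) m := by
  classical
  have hm := he.complete.idem m
  refine upper_count (isUpperSet_up j) (fun Λ => mult K e (traces e j Λ) m) _ ?_ ?_ ?_ hΛ hsub
  · rw [mult_eq_zero_iff, traces_empty]
    exact fun x => Subsingleton.elim _ _
  · intro Λ hsub hΛ k hk _
    obtain ⟨f, hf⟩ := hA.exists_surjective_std he hsub hΛ hk
    have h1 := mult_le_of_surjective (K := K) hm f hf
    have h2 := mult_eq_subquot_add (K := K) hm (traces_mono (e := e) (j := j)
      (Finset.erase_subset k Λ))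
    omega
  · rw [← hA.mult_P he.complete, traces_up he, mult_congr Submodule.topEquiv]

open Classical in
theorem IsOneQuasiHereditary.step_traces {j k : ι} {Λ : Finset ι} (hsub : Λ ⊆ up j)
    (hΛ : IsUpperSet (Λ : Set ι)) (hk : k ∈ Λ) (hmin : ∀ l ∈ Λ, ¬ l < k) :
    Step (Std K e) (traces e j (Λ.erase k)) (traces e j Λ) := by
  have hle := traces_mono (e := e) (j := j) (Finset.erase_subset k Λ)
  refine ⟨hle, k, ?_⟩
  obtain ⟨f, hf⟩ := hA.exists_surjective_std he hsub hΛ hk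
  refine ⟨(LinearEquiv.ofBijective f ⟨injective_of_mult_le (K := K) he.complete f hf
    fun m => ?_, hf⟩).symm⟩
  have h2 := mult_eq_subquot_add (K := K) (he.complete.idem m) hle
  have hΛ' : IsUpperSet ((Λ.erase k : Finset ι) : Set ι) := isUpperSet_erase hΛ hmin
  rw [hA.mult_traces he hsub hΛ, hA.mult_traces he ((Finset.erase_subset k Λ).trans hsub) hΛ',
    ← Finset.add_sum_erase _ _ hk] at h2
  omega

theorem IsOneQuasiHereditary.reflTransGen_traces {j : ι} {Λ : Finset ι} (hsub : Λ ⊆ up j)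
    (hΛ : IsUpperSet (Λ : Set ι)) : Relation.ReflTransGen (Step (Std K e)) (traces e j Λ) ⊤ := by
  classical
  refine upper_induction
    (motive := fun Λ => Relation.ReflTransGen (Step (Std K e)) (traces e j Λ) ⊤)
    (isUpperSet_up j) ?_ ?_ hΛ hsub
  · rw [traces_up he]
  · intro Λ hsub hΛ k hk hmin ih
    exact ih.head (hA.step_traces he hsub hΛ hk hmin)

/-- Descending induction: each factor `Δ(k)` removes exactly the vertex `k`, which its simple
quotient detects. -/
theorem IsOneQuasiHereditary.exists_eq_traces {j : ι} {U : Submodule A (P e j)}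
    (h : Relation.ReflTransGen (Step (Std K e)) U ⊤) :
    ∃ Λ ⊆ up j, IsUpperSet (Λ : Set ι) ∧ U = traces e j Λ := by
  classical
  have : IsArtinianRing A := isArtinian_of_tower K inferInstance
  induction h using Relation.ReflTransGen.head_induction_on with
  | refl => exact ⟨up j, subset_rfl, isUpperSet_up j, (traces_up he j).symm⟩
  | @head U V hUV _ ih =>
    obtain ⟨Λ, hsub, hΛ, rfl⟩ := ih
    obtain ⟨hUV, k, ⟨φ⟩⟩ := hUV
    obtain ⟨f, hf, hker⟩ := exists_of_subquotEquiv φ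
    have hmem : ∀ {i}, i ∈ Λ → ∀ x : P e j, e i • x ∈ traces e j Λ := fun hi x =>
      trace_le_traces hi (smul_mem_trace _ x)
    have hnt : Nontrivial (Std K e k) := by
      by_contra h
      rw [not_nontrivial_iff_subsingleton] at h
      have := hA.mult_std_self k
      rw [(mult_eq_zero_iff K e _ k).2 fun _ => Subsingleton.elim _ _] at this
      exact zero_ne_one this
    obtain ⟨C, hC⟩ := IsCoatomic.exists_coatom (Submodule A (Std K e k))
    have hT : IsSimpleModule A (Std K e k ⧸ C) := isSimpleModule_iff_isCoatom.2 hC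
    obtain ⟨y, hy⟩ : ∃ y : Std K e k ⧸ C, e k • y ≠ 0 := by
      by_contra! h
      refine hC.1 ?_
      have h0 : C.mkQ ((stdKer K e k).mkQ (gen e k)) = 0 := by
        rw [← h (C.mkQ ((stdKer K e k).mkQ (gen e k))), ← map_smul, ← map_smul,
          idem_smul_gen (he.complete.idem k)]
      rw [Submodule.eq_top_iff']
      intro x
      obtain ⟨x, rfl⟩ := (stdKer K e k).mkQ_surjective x
      rw [← smul_gen (he.complete.idem k) x, map_smul]
      exact C.smul_mem _ ((Submodule.Quotient.mk_eq_zero _).1 h0)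
    let q : traces e j Λ →ₗ[A] Std K e k ⧸ C := C.mkQ ∘ₗ f
    have hq : Function.Surjective q := C.mkQ_surjective.comp hf
    -- The image of `e_i x` in the simple quotient is fixed by `e_i`, and a simple module is nonzero
    -- at only one vertex, here `k`.
    have hnot : ∀ {i}, i ∈ Λ → i ≠ k → trace e (P e j) i ≤
        (LinearMap.ker q).map (traces e j Λ).subtype := by
      intro i hi hik
      refine trace_le.2 fun x => ⟨⟨e i • x, hmem hi x⟩, ?_, rfl⟩
      by_contra hne
      have hidem : e i • q ⟨e i • x, hmem hi x⟩ = q ⟨e i • x, hmem hi x⟩ := by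
        rw [← map_smul]
        congr 1
        exact Subtype.ext (by
          change e i • e i • x = e i • x
          rw [← mul_smul, he.complete.idem i])
      refine hik (he.eq_of_isSimpleModule (x := q ⟨e i • x, hmem hi x⟩) ?_ hy)
      rwa [hidem]
    have hex : ¬ ∀ i ∈ Λ, trace e (P e j) i ≤ (LinearMap.ker q).map (traces e j Λ).subtype := by
      intro h
      have hle : traces e j Λ ≤ (LinearMap.ker q).map (traces e j Λ).subtype := iSup₂_le h
      obtain ⟨z, rfl⟩ := hq y
      obtain ⟨z', hz', hzz⟩ := hle z.2
      obtain rfl : z' = z := Subtype.ext hzz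
      exact hy (by rw [LinearMap.mem_ker.1 hz', smul_zero])
    have hk : k ∈ Λ := by
      by_contra hk
      exact hex fun i hi => hnot hi (ne_of_mem_of_not_mem hi hk)
    -- If `l < k` were in `Λ`, the trace at `k` would lie in the trace at `l`, which dies in the
    -- simple quotient; then everything would die.
    have hmin : ∀ l ∈ Λ, ¬ l < k := by
      intro l hl hlk
      refine hex fun i hi => ?_
      rcases eq_or_ne i k with rfl | hik
      · exact (hA.trace_anti he (mem_up.1 (hsub hl)) hlk.le).trans (hnot hl hlk.ne)
      · exact hnot hi hik
    have hsub' := (Finset.erase_subset k Λ).trans hsub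
    have hΛ' : IsUpperSet ((Λ.erase k : Finset ι) : Set ι) := isUpperSet_erase hΛ hmin
    refine ⟨Λ.erase k, hsub', hΛ', ?_⟩
    refine (eq_of_mult_le (K := K) he.complete ?_ fun m => ?_).symm
    · refine iSup₂_le fun l hl => trace_le.2 fun x => ?_
      obtain ⟨hlk, hl⟩ := Finset.mem_erase.1 hl
      refine (hker ⟨e l • x, hmem hl x⟩).1 ?_
      have hle : ¬ l ≤ k := fun h => hmin l hl (lt_of_le_of_ne h hlk)
      rw [← smul_std_eq_zero (K := K) (e := e) hle (f ⟨e l • x, hmem hl x⟩), ← map_smul]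
      congr 1
      exact Subtype.ext (by
        change e l • x = e l • e l • x
        rw [← mul_smul, he.complete.idem l])
    · have := mult_eq_add_of_subquot (K := K) (he.complete.idem m) hUV f hf hker
      rw [hA.mult_traces he hsub hΛ, ← Finset.add_sum_erase _ _ hk] at this
      rw [hA.mult_traces he hsub' hΛ']
      omega

end DeltaGood

/-! ### Intersections of rejects -/

section Rejects

variable {A : Type u} [Ring A] {ι : Type w} [PartialOrder ι] [BoundedOrder ι] (e : ι → A)

/-- The largest submodule of `P(1)` annihilated by all `e i` with `i` in `Λ`. -/
def rejects (Λ : Finset ι) : Submodule A (P e ⊥) := ⨅ i ∈ Λ, reject e (P e ⊥) i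

variable {e}

theorem mem_rejects {Λ : Finset ι} {x : P e ⊥} :
    x ∈ rejects e Λ ↔ ∀ i ∈ Λ, x ∈ reject e (P e ⊥) i := by
  simp [rejects, Submodule.mem_iInf]

theorem rejects_anti {Λ Λ' : Finset ι} (h : Λ ⊆ Λ') : rejects e Λ' ≤ rejects e Λ :=
  fun _ hx => mem_rejects.2 fun i hi => mem_rejects.1 hx i (h hi)

theorem rejects_empty : rejects e ∅ = ⊤ := by simp [rejects]

end Rejects

/-! ### `∇`-good submodules of the factor modules of `P(1)` -/

section NablaGood

variable {K : Type v} [Field K] {A : Type u} [Ring A] [Algebra K A] [FiniteDimensional K A]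
  {ι : Type w} [Fintype ι] [PartialOrder ι] [BoundedOrder ι] {e : ι → A}

variable (he : IsBasicFamily e) (hA : IsOneQuasiHereditary K e)
include he hA

/-- Such functionals vanish on the traces in `P(m)` of all `P(l)` with `l > k`. In the remaining
quotient of `P(m)` only a factor `Δ(k)` contains `S(k)`, and it occurs only for `m ≤ k`. -/
theorem IsOneQuasiHereditary.mult_iInf_reject_le (k m : ι) :
    mult K e ↥(⨅ l > k, reject e (I K e k) l) m ≤ mult K e (Std K e k) m := by
  classical
  have hsub : (up m).filter (k < ·) ⊆ up m := Finset.filter_subset _ _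
  have hup : IsUpperSet (((up m).filter (k < ·) : Finset ι) : Set ι) := by
    intro a b hab ha
    rw [Finset.mem_coe, Finset.mem_filter] at ha ⊢
    exact ⟨isUpperSet_up m hab ha.1, ha.2.trans_le hab⟩
  refine (mult_le_of_forall_eq_zero (K := K) (he.complete.idem m)
    (Q := traces e m ((up m).filter (k < ·))) fun f hf x hx => ?_).trans ?_
  · have hle : traces e m ((up m).filter (k < ·)) ≤ LinearMap.ker (homP e m f) := by
      refine iSup₂_le fun l hl => trace_le.2 fun y => ?_
      rw [LinearMap.mem_ker, map_smul, homP_apply]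
      simp only [Submodule.mem_iInf] at hf
      exact mem_reject.1 (hf l (Finset.mem_filter.1 hl).2) y
    have h0 : (x : A) • f = 0 := hle hx
    have h1 : (f : D K A) (1 * (x : A)) = 0 := congrArg (fun g : I K e k => (g : D K A) 1) h0
    rwa [one_mul] at h1
  · have h1 := mult_eq_quotient_add (K := K) (he.complete.idem k)
      (traces e m ((up m).filter (k < ·)))
    rw [hA.mult_traces he hsub hup, hA.mult_P he.complete, ← Finset.sum_sdiff hsub,
      Nat.add_right_cancel_iff] at h1
    have h2 : ∀ l ∈ up m \ (up m).filter (k < ·), mult K e (Std K e l) k =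
        if l = k then 1 else 0 := by
      intro l hl
      rw [hA.mult_std_eq]
      simp only [Finset.mem_sdiff, Finset.mem_filter, not_and] at hl
      refine if_congr ⟨fun h => ?_, fun h => h.symm.le⟩ rfl rfl
      by_contra hne
      exact hl.2 hl.1 (lt_of_le_of_ne h (Ne.symm hne))
    rw [← h1, Finset.sum_congr rfl h2, Finset.sum_ite_eq', hA.mult_std_eq]
    by_cases hmk : m ≤ k
    · rw [if_pos hmk]
      split_ifs <;> omega
    · rw [if_neg hmk, if_neg]
      simp [mem_up, hmk]

theorem IsOneQuasiHereditary.costd_eq (k : ι) :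
    Costd K e k = ⨅ l > k, reject e (I K e k) l := by
  refine le_antisymm (le_iInf₂ fun l hl => le_reject.2 fun x hx => ?_)
    ((costd_isGreatest K e k).2 fun m hm => ?_)
  · exact congrArg Subtype.val (smul_costd_eq_zero (K := K) (e := e) hl.not_ge ⟨x, hx⟩)
  · have := hA.mult_iInf_reject_le he k m
    rw [hA.mult_std_eq, if_neg hm] at this
    omega

theorem IsOneQuasiHereditary.rejects_up (j : ι) : rejects e (up j) = reject e (P e ⊥) j := by
  ext x
  rw [mem_rejects]
  exact ⟨fun h => h j (mem_up.2 le_rfl), fun h i hi => hA.reject_mono he (mem_up.1 hi) h⟩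

open Classical in
-- Restrict a surjection `P(1) → I(k)`, whose kernel is the reject at `k`; vertices `l > k` stay in
-- `Λ.erase k`, so the values lie in `∇(k)`.
theorem IsOneQuasiHereditary.exists_hom_costd {k : ι} {Λ : Finset ι}
    (hΛ : IsUpperSet (Λ : Set ι)) (hk : k ∈ Λ) :
    ∃ f : rejects e (Λ.erase k) →ₗ[A] Costd K e k,
      ∀ x, f x = 0 ↔ (x : P e ⊥) ∈ rejects e Λ := by
  obtain ⟨g, hg⟩ := hA.exists_surjective_I he k
  refine ⟨g.restrict fun x hx => ?_, fun x => ?_⟩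
  · rw [hA.costd_eq he]
    simp only [Submodule.mem_iInf]
    exact fun l hl => map_mem_reject g
      (mem_rejects.1 hx l (Finset.mem_erase.2 ⟨hl.ne', hΛ hl.le hk⟩))
  · have h1 : (x : P e ⊥) ∈ LinearMap.ker g ↔ (x : P e ⊥) ∈ reject e (P e ⊥) k := by
      rw [hA.ker_eq_reject he hg]
    constructor
    · intro h
      refine mem_rejects.2 fun i hi => ?_
      rcases eq_or_ne i k with rfl | hik
      · exact h1.1 (congrArg Subtype.val h)
      · exact mem_rejects.1 x.2 i (Finset.mem_erase.2 ⟨hik, hi⟩)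
    · exact fun h => Subtype.ext (h1.2 (mem_rejects.1 h k hk))

/-- Each deletion costs at most `∇(k)`, and the intersection over all vertices is zero, so the costs
add up exactly. -/
theorem IsOneQuasiHereditary.mult_rejects_add {Λ : Finset ι}
    (hΛ : IsUpperSet (Λ : Set ι)) (m : ι) :
    mult K e (P e ⊥) m = ∑ l ∈ Λ, mult K e (Std K e l) m + mult K e (rejects e Λ) m := by
  classical
  have hm := he.complete.idem m
  have hadd := fun Λ => mult_eq_quotient_add (K := K) hm (rejects e Λ)
  rw [hadd Λ, Nat.add_right_cancel_iff]
  have hsub : Λ ⊆ up ⊥ := fun i _ => mem_up.2 bot_le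
  refine upper_count (isUpperSet_up ⊥) (fun Λ => mult K e (P e ⊥ ⧸ rejects e Λ) m) _ ?_ ?_ ?_
    hΛ hsub
  · rw [mult_eq_zero_iff, rejects_empty]
    exact fun x => Subsingleton.elim _ _
  · intro Λ _ hΛ k hk _
    obtain ⟨f, hf⟩ := hA.exists_hom_costd he hΛ hk
    have h1 := mult_eq_range_add (K := K) hm (rejects_anti (Finset.erase_subset k Λ)) f hf
    have h2 := mult_submodule_le (K := K) hm (LinearMap.range f)
    have h3 := hA.mult_iInf_reject_le he k m
    rw [← hA.costd_eq he] at h3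
    have h4 := hadd Λ
    have h5 := hadd (Λ.erase k)
    omega
  · have h1 := hadd (up ⊥)
    have h2 : mult K e (rejects e (up (⊥ : ι))) m = 0 := by
      rw [mult_eq_zero_iff, hA.rejects_up he, hA.reject_bot he]
      exact fun x => Subsingleton.elim _ _
    rw [← hA.mult_P he.complete]
    omega

open Classical in
theorem IsOneQuasiHereditary.mult_std_le_range {k : ι} {Λ : Finset ι}
    (hΛ : IsUpperSet (Λ : Set ι)) (hk : k ∈ Λ) (hmin : ∀ l ∈ Λ, ¬ l < k)
    {f : rejects e (Λ.erase k) →ₗ[A] Costd K e k}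
    (hf : ∀ x, f x = 0 ↔ (x : P e ⊥) ∈ rejects e Λ) (m : ι) :
    mult K e (Std K e k) m ≤ mult K e (LinearMap.range f) m := by
  have h1 := mult_eq_range_add (K := K) (he.complete.idem m)
    (rejects_anti (Finset.erase_subset k Λ)) f hf
  have h2 := hA.mult_rejects_add he hΛ m
  have h3 := hA.mult_rejects_add he (isUpperSet_erase hΛ hmin) m
  rw [← Finset.add_sum_erase _ _ hk] at h2
  omega

/-- The lower bound comes from the upper set generated by `k`, where `k` is minimal and the
subquotient embeds in `∇(k)`. -/
theorem IsOneQuasiHereditary.mult_costd (k m : ι) :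
    mult K e (Costd K e k) m = mult K e (Std K e k) m := by
  classical
  refine le_antisymm ?_ ?_
  · rw [hA.costd_eq he]
    exact hA.mult_iInf_reject_le he k m
  · have hk : k ∈ up k := mem_up.2 le_rfl
    obtain ⟨f, hf⟩ := hA.exists_hom_costd he (isUpperSet_up k) hk
    exact (hA.mult_std_le_range he (isUpperSet_up k) hk
      (fun l hl => (mem_up.1 hl).not_gt) hf m).trans
      (mult_submodule_le (he.complete.idem m) _)

open Classical in
theorem IsOneQuasiHereditary.step_rejects {k : ι} {Λ : Finset ι}
    (hΛ : IsUpperSet (Λ : Set ι)) (hk : k ∈ Λ) (hmin : ∀ l ∈ Λ, ¬ l < k) :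
    Step (fun i => Costd K e i) (rejects e Λ) (rejects e (Λ.erase k)) := by
  obtain ⟨f, hf⟩ := hA.exists_hom_costd he hΛ hk
  refine ⟨rejects_anti (Finset.erase_subset k Λ), k, ⟨subquotEquiv f ?_ hf⟩⟩
  rw [← LinearMap.range_eq_top]
  refine eq_top_of_mult_le (K := K) he.complete fun m => ?_
  rw [hA.mult_costd he]
  exact hA.mult_std_le_range he hΛ hk hmin hf m

theorem IsOneQuasiHereditary.reflTransGen_rejects {j : ι} {Λ : Finset ι} (hsub : Λ ⊆ up j)
    (hΛ : IsUpperSet (Λ : Set ι)) : Relation.ReflTransGen (Step fun i => Costd K e i)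
      (reject e (P e ⊥) j) (rejects e Λ) := by
  classical
  refine upper_induction (motive := fun Λ => Relation.ReflTransGen (Step fun i => Costd K e i)
    (reject e (P e ⊥) j) (rejects e Λ)) (isUpperSet_up j) ?_ ?_ hΛ hsub
  · rw [hA.rejects_up he]
  · intro Λ hsub hΛ k hk hmin ih
    exact ih.tail (hA.step_rejects he hΛ hk hmin)

theorem IsOneQuasiHereditary.exists_eq_rejects {j : ι} {W : Submodule A (P e ⊥)}
    (h : Relation.ReflTransGen (Step fun i => Costd K e i) (reject e (P e ⊥) j) W) :
    ∃ Λ ⊆ up j, IsUpperSet (Λ : Set ι) ∧ W = rejects e Λ := by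
  classical
  have : IsArtinianRing A := isArtinian_of_tower K inferInstance
  induction h with
  | refl => exact ⟨up j, subset_rfl, isUpperSet_up j, (hA.rejects_up he j).symm⟩
  | @tail V W _ hVW ih =>
    obtain ⟨Λ, hsub, hΛ, rfl⟩ := ih
    obtain ⟨hVW, k, ⟨φ⟩⟩ := hVW
    obtain ⟨f, hf, hker⟩ := exists_of_subquotEquiv φ
    have hk1 := hA.mult_costd he k k
    rw [hA.mult_std_self] at hk1
    have hne : (⊤ : Submodule A (Costd K e k)) ≠ ⊥ := by
      intro h
      rw [(mult_eq_zero_iff K e _ k).2 fun x => (Submodule.mem_bot A).1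
        (h ▸ Submodule.mem_top : e k • x ∈ (⊥ : Submodule A (Costd K e k)))] at hk1
      exact zero_ne_one hk1
    have : IsArtinian A (Costd K e k) := isArtinian_of_tower K inferInstance
    obtain ⟨T, hT, -⟩ := (eq_bot_or_exists_atom_le (⊤ : Submodule A (Costd K e k))).resolve_left hne
    have hTs : IsSimpleModule A T := isSimpleModule_iff_isAtom.2 hT
    obtain ⟨t, ht, ht0⟩ := Submodule.exists_mem_ne_zero_of_ne_bot hT.1
    -- No nonzero submodule of `I(k)` is annihilated by `e k`, so the simple submodule `T` lives at
    -- the vertex `k`.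
    obtain ⟨y, hy⟩ : ∃ y : T, e k • y ≠ 0 := by
      by_contra! h
      have h1 : (⟨t, ht⟩ : T) ∈ reject e T k := fun a => h _
      rw [reject_eq_bot_of_injective_I (K := K) ((Costd K e k).subtype ∘ₗ T.subtype)
        ((Costd K e k).injective_subtype.comp T.injective_subtype), Submodule.mem_bot] at h1
      exact ht0 (congrArg Subtype.val h1)
    obtain ⟨z, hz⟩ := hf y
    -- Here `e_i a x` lies in the kernel of `f`, which `e_i` annihilates; idempotency then gives
    -- `e_i a x = 0`.
    have hvan : ∀ {i}, i ∈ Λ → ∀ x : W, (∀ a : A, e i • a • f x = 0) →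
        (x : P e ⊥) ∈ reject e (P e ⊥) i := by
      intro i hi x hx a
      have h1 : e i • a • (x : P e ⊥) ∈ rejects e Λ := (hker (e i • a • x)).1 (by
        rw [map_smul, map_smul, hx])
      have h2 := smul_eq_zero_of_mem_reject (mem_rejects.1 h1 i hi)
      rwa [← mul_smul, he.complete.idem i] at h2
    have hnot : ∀ {i}, i ∈ Λ → i ≠ k → (z : P e ⊥) ∈ reject e (P e ⊥) i := by
      intro i hi hik
      refine hvan hi z fun a => ?_
      by_contra hne
      refine hik (he.eq_of_isSimpleModule (T := T) (x := a • y) (fun h => hne ?_) hy)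
      rw [hz]
      exact congrArg Subtype.val h
    have hex : ¬ ∀ i ∈ Λ, (z : P e ⊥) ∈ reject e (P e ⊥) i := by
      intro h
      have h0 := (hker z).2 (mem_rejects.2 h)
      refine hy (Subtype.ext ?_)
      change e k • (y : Costd K e k) = 0
      rw [← hz, h0, smul_zero]
    have hk : k ∈ Λ := by
      by_contra hk
      exact hex fun i hi => hnot hi (ne_of_mem_of_not_mem hi hk)
    have hmin : ∀ l ∈ Λ, ¬ l < k := by
      intro l hl hlk
      refine hex fun i hi => ?_
      rcases eq_or_ne i k with rfl | hik
      · exact hA.reject_mono he hlk.le (hnot hl hlk.ne)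
      · exact hnot hi hik
    have hΛ' : IsUpperSet ((Λ.erase k : Finset ι) : Set ι) := isUpperSet_erase hΛ hmin
    refine ⟨Λ.erase k, (Finset.erase_subset k Λ).trans hsub, hΛ',
      eq_of_mult_le (K := K) he.complete (fun x hx => mem_rejects.2 fun l hl => ?_) fun m => ?_⟩
    · obtain ⟨hlk, hl⟩ := Finset.mem_erase.1 hl
      have hle : ¬ l ≤ k := fun h => hmin l hl (lt_of_le_of_ne h hlk)
      exact hvan hl ⟨x, hx⟩ fun a => smul_costd_eq_zero hle _
    · have h1 := mult_eq_add_of_subquot (K := K) (he.complete.idem m) hVW f hf hker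
      have h2 := hA.mult_rejects_add he hΛ m
      have h3 := hA.mult_rejects_add he hΛ' m
      rw [← Finset.add_sum_erase _ _ hk] at h2
      rw [hA.mult_costd he] at h1
      omega

end NablaGood

/-! ### Arbitrary index sets and the two characterizations -/

section Characterizations

variable {K : Type v} [Field K] {A : Type u} [Ring A] [Algebra K A] [FiniteDimensional K A]
  {ι : Type w} [Fintype ι] [PartialOrder ι] [BoundedOrder ι] {e : ι → A}

open Classical in
/-- The upper set generated by a set of vertices, as a finset. -/
noncomputable def upperFinset (Λ : Set ι) : Finset ι := Finset.univ.filter fun k => ∃ i ∈ Λ, i ≤ k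

omit [BoundedOrder ι] in
theorem mem_upperFinset {Λ : Set ι} {k : ι} : k ∈ upperFinset Λ ↔ ∃ i ∈ Λ, i ≤ k := by
  simp [upperFinset]

omit [BoundedOrder ι] in
theorem isUpperSet_upperFinset (Λ : Set ι) : IsUpperSet (upperFinset Λ : Set ι) := by
  intro a b hab ha
  rw [Finset.mem_coe, mem_upperFinset] at ha ⊢
  obtain ⟨i, hi, hia⟩ := ha
  exact ⟨i, hi, hia.trans hab⟩

omit [BoundedOrder ι] in
theorem upperFinset_subset_up {j : ι} {Λ : Set ι} (h : Λ ⊆ Set.Ici j) :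
    upperFinset Λ ⊆ up j := fun k hk => by
  obtain ⟨i, hi, hik⟩ := mem_upperFinset.1 hk
  exact mem_up.2 (le_trans (h hi) hik)

omit [BoundedOrder ι] in
theorem upperFinset_coe {Λ : Finset ι} (h : IsUpperSet (Λ : Set ι)) :
    upperFinset (Λ : Set ι) = Λ := by
  ext k
  rw [mem_upperFinset]
  exact ⟨fun ⟨i, hi, hik⟩ => h hik hi, fun hk => ⟨k, hk, le_rfl⟩⟩

variable (he : IsBasicFamily e) (hA : IsOneQuasiHereditary K e)
include he hA

theorem IsOneQuasiHereditary.iSup_projSub {j : ι} {Λ : Set ι} (h : Λ ⊆ Set.Ici j) :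
    ⨆ i ∈ Λ, projSub e j i = traces e j (upperFinset Λ) := by
  refine le_antisymm (iSup₂_le fun i hi => ?_) (iSup₂_le fun k hk => ?_)
  · rw [hA.projSub_eq he (h hi)]
    exact trace_le_traces (mem_upperFinset.2 ⟨i, hi, le_rfl⟩)
  · obtain ⟨i, hi, hik⟩ := mem_upperFinset.1 hk
    refine (hA.trace_anti he (h hi) hik).trans ?_
    rw [← hA.projSub_eq he (h hi)]
    exact le_iSup₂ (f := fun i (_ : i ∈ Λ) => projSub e j i) i hi

theorem IsOneQuasiHereditary.iInf_kerInj (Λ : Set ι) :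
    ⨅ i ∈ Λ, kerInj K e i = rejects e (upperFinset Λ) := by
  refine le_antisymm (le_iInf₂ fun k hk => ?_) (le_iInf₂ fun i hi => ?_)
  · obtain ⟨i, hi, hik⟩ := mem_upperFinset.1 hk
    refine le_trans ?_ (hA.reject_mono he hik)
    rw [← hA.kerInj_eq he i]
    exact iInf₂_le (f := fun i (_ : i ∈ Λ) => kerInj K e i) i hi
  · rw [hA.kerInj_eq he]
    exact fun x hx => mem_rejects.1 hx i (mem_upperFinset.2 ⟨i, hi, le_rfl⟩)

theorem IsOneQuasiHereditary.isDeltaGood_iff {j : ι} {M : Type*} [AddCommGroup M] [Module A M]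
    [Module.Finite A M] (φ : Top A M ≃ₗ[A] S e j) :
    IsDeltaGood K e M ↔ ∃ Λ : Set ι, Λ ⊆ Set.Ici j \ {j} ∧
      Nonempty (M ≃ₗ[A] (P e j ⧸ (⨆ i ∈ Λ, projSub e j i))) := by
  have : IsArtinianRing A := isArtinian_of_tower K inferInstance
  constructor
  · intro hM
    obtain ⟨f, hf⟩ := exists_surjective_of_top (he.complete.idem j) φ
    obtain ⟨Λ, hsub, hΛ, hker⟩ :=
      hA.exists_eq_traces he ((isGood_iff_of_surjective f hf).1 hM)
    have hIci : (Λ : Set ι) ⊆ Set.Ici j := fun i hi => mem_up.1 (hsub hi)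
    refine ⟨Λ, fun i hi => ⟨hIci hi, ?_⟩, ⟨(f.quotKerEquivOfSurjective hf).symm.trans
      (Submodule.quotEquivOfEq _ _ ?_)⟩⟩
    -- Were `j` in `Λ`, the kernel would be all of `P(j)` and the module zero, contradicting its
    -- nonzero top.
    · rintro rfl
      have htop : LinearMap.ker f = ⊤ := by
        rw [hker, ← top_le_iff, ← trace_P_self (he.complete.idem i)]
        exact trace_le_traces hi
      have := (he.isSimpleModule_S i).nontrivial
      obtain ⟨y, hy⟩ := exists_ne (0 : S e i)
      obtain ⟨x, hx⟩ := Submodule.mkQ_surjective _ (φ.symm y)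
      obtain ⟨z, rfl⟩ := hf x
      have hz : f z = 0 := LinearMap.mem_ker.1 (htop ▸ Submodule.mem_top)
      rw [hz, map_zero] at hx
      exact hy ((LinearEquiv.map_eq_zero_iff _).1 hx.symm)
    · rw [hker, hA.iSup_projSub he hIci, upperFinset_coe hΛ]
  · rintro ⟨Λ, hΛ, ⟨ψ⟩⟩
    have hIci : Λ ⊆ Set.Ici j := fun i hi => (hΛ hi).1
    refine (isGood_iff_of_surjective (ψ.symm.toLinearMap ∘ₗ Submodule.mkQ _)
      (ψ.symm.surjective.comp (Submodule.mkQ_surjective _))).2 ?_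
    rw [LinearEquiv.ker_comp, Submodule.ker_mkQ, hA.iSup_projSub he hIci]
    exact hA.reflTransGen_traces he (upperFinset_subset_up hIci) (isUpperSet_upperFinset Λ)

/-- The socle embeds `N` in `I(j)`, which is `P(1)/𝒦(j)`; `W` is the preimage of `N`. -/
theorem IsOneQuasiHereditary.exists_equiv_subquot {j : ι} {N : Type*} [AddCommGroup N]
    [Module A N] [Module.Finite A N] (φ : socle A N ≃ₗ[A] S e j) :
    ∃ W : Submodule A (P e ⊥), kerInj K e j ≤ W ∧ Nonempty (N ≃ₗ[A] Subquot W (kerInj K e j)) := by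
  have : IsArtinianRing A := isArtinian_of_tower K inferInstance
  -- The statement provides only an `A`-module; functionals on it need the induced `K`-structure.
  let _ : Module K N := Module.compHom N (algebraMap K A)
  have : IsScalarTower K A N := IsScalarTower.of_algebraMap_smul fun _ _ => rfl
  have : FiniteDimensional K N := Module.Finite.trans A N
  have : IsArtinian A N := isArtinian_of_tower K inferInstance
  obtain ⟨f, hf⟩ := exists_injective_of_socle (K := K) (he.complete.idem j)
    (he.isSimpleModule_S j) φ
  obtain ⟨g, hg⟩ := hA.exists_surjective_I he j
  have hker : kerInj K e j = LinearMap.ker g := by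
    rw [hA.kerInj_eq he, hA.ker_eq_reject he hg]
  refine ⟨(LinearMap.range f).comap g, hker ▸ fun x hx => ?_, ⟨?_⟩⟩
  · rw [Submodule.mem_comap, LinearMap.mem_ker.1 hx]
    exact Submodule.zero_mem _
  · refine (LinearEquiv.ofInjective f hf).trans (subquotEquiv
      (g.restrict (p := (LinearMap.range f).comap g) fun x hx => hx) ?_ fun x => ?_).symm
    · rintro ⟨y, hy⟩
      obtain ⟨x, rfl⟩ := hg y
      exact ⟨⟨x, hy⟩, rfl⟩
    · rw [hker]
      exact Subtype.ext_iff

theorem IsOneQuasiHereditary.isNablaGood_iff {j : ι} {N : Type*} [AddCommGroup N] [Module A N]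
    [Module.Finite A N] (φ : socle A N ≃ₗ[A] S e j) :
    IsNablaGood K e N ↔ ∃ Λ : Set ι, Λ ⊆ Set.Ici j \ {j} ∧
      Nonempty (N ≃ₗ[A] Subquot (⨅ i ∈ Λ, kerInj K e i) (kerInj K e j)) := by
  have : IsArtinianRing A := isArtinian_of_tower K inferInstance
  constructor
  · intro hN
    obtain ⟨W, hW, ⟨ψ⟩⟩ := hA.exists_equiv_subquot he φ
    have hgood := (isGood_iff_of_subquot hW ψ).1 hN
    rw [hA.kerInj_eq he] at hgood
    obtain ⟨Λ, hsub, hΛ, rfl⟩ := hA.exists_eq_rejects he hgood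
    refine ⟨Λ, fun i hi => ⟨mem_up.1 (hsub hi), ?_⟩, ⟨?_⟩⟩
    · rintro rfl
      have hsubsingleton : ∀ x : N, x = 0 := fun x => by
        obtain ⟨y, hy⟩ := Submodule.mkQ_surjective _ (ψ x)
        rw [← LinearEquiv.map_eq_zero_iff ψ, ← hy]
        refine (Submodule.Quotient.mk_eq_zero _).2 ?_
        change (y : P e ⊥) ∈ kerInj K e i
        rw [hA.kerInj_eq he]
        exact mem_rejects.1 y.2 i hi
      have := (he.isSimpleModule_S i).nontrivial
      obtain ⟨y, hy⟩ := exists_ne (0 : S e i)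
      exact hy ((LinearEquiv.map_eq_zero_iff φ.symm).1 (Subtype.ext (hsubsingleton _)))
    · rwa [hA.iInf_kerInj he, upperFinset_coe hΛ]
  · rintro ⟨Λ, hΛ, ⟨ψ⟩⟩
    have hIci : Λ ⊆ Set.Ici j := fun i hi => (hΛ hi).1
    have hle : kerInj K e j ≤ ⨅ i ∈ Λ, kerInj K e i := le_iInf₂ fun i hi => by
      rw [hA.kerInj_eq he, hA.kerInj_eq he]
      exact hA.reject_mono he (hIci hi)
    refine (isGood_iff_of_subquot hle ψ).2 ?_
    rw [hA.iInf_kerInj he, hA.kerInj_eq he]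
    exact hA.reflTransGen_rejects he (upperFinset_subset_up hIci) (isUpperSet_upperFinset Λ)

end Characterizations
end QH

theorem mainTheorem8 {K : Type*} [Field K] [IsAlgClosed K]
    {A : Type*} [Ring A] [Algebra K A] [FiniteDimensional K A]
    {ι : Type*} [Fintype ι] [PartialOrder ι] [BoundedOrder ι]
    (e : ι → A) (he : QH.IsBasicFamily e) (hA : QH.IsOneQuasiHereditary K e) (j : ι) :
    -- `P(j)` has a unique submodule isomorphic to `P(i)`, for `i ≥ j`
    (∀ i, j ≤ i → ∃! U : Submodule A ↥(QH.P e j), Nonempty (↥U ≃ₗ[A] ↥(QH.P e i))) ∧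
    -- surjections `P(1) → I(i)` exist and have the same kernel, which contains that for `j ≤ i`
    (∀ i, ∃! U : Submodule A ↥(QH.P e ⊥),
      ∃ f : ↥(QH.P e ⊥) →ₗ[A] ↥(QH.I K e i), Function.Surjective f ∧ U = LinearMap.ker f) ∧
    (∀ i, j ≤ i → QH.kerInj K e j ≤ QH.kerInj K e i) ∧
    -- modules with top `S(j)`
    (∀ (M : Type*) [AddCommGroup M] [Module A M] [Module.Finite A M],
      Nonempty (QH.Top A M ≃ₗ[A] QH.S e j) →
      (QH.IsDeltaGood K e M ↔ ∃ Λ : Set ι, Λ ⊆ Set.Ici j \ {j} ∧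
        Nonempty (M ≃ₗ[A] (↥(QH.P e j) ⧸ (⨆ i ∈ Λ, QH.projSub e j i))))) ∧
    -- modules with socle `S(j)`
    (∀ (N : Type*) [AddCommGroup N] [Module A N] [Module.Finite A N],
      Nonempty (↥(QH.socle A N) ≃ₗ[A] QH.S e j) →
      (QH.IsNablaGood K e N ↔ ∃ Λ : Set ι, Λ ⊆ Set.Ici j \ {j} ∧
        Nonempty (N ≃ₗ[A] QH.Subquot (⨅ i ∈ Λ, QH.kerInj K e i) (QH.kerInj K e j)))) := by
  refine ⟨fun i hi => ⟨_, hA.nonempty_trace_equiv he hi, fun U ⟨φ⟩ => hA.eq_trace he hi φ⟩,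
    fun i => ?_, fun i hi => ?_, fun M _ _ _ ⟨φ⟩ => hA.isDeltaGood_iff he φ,
    fun N _ _ _ ⟨φ⟩ => hA.isNablaGood_iff he φ⟩
  · obtain ⟨g, hg⟩ := hA.exists_surjective_I he i
    refine ⟨_, ⟨g, hg, rfl⟩, ?_⟩
    rintro U ⟨f, hf, rfl⟩
    exact (hA.ker_eq_reject he hf).trans (hA.ker_eq_reject he hg).symm
  · rw [hA.kerInj_eq he, hA.kerInj_eq he]
    exact hA.reject_mono he hi
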